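/- **Models.** Let $Ag$ be a finite set of agents, and let $S=\prod_{i\in Ag}S_i$ (global states) and $Act=\prod_{i\in Ag}Act_i$ (joint actions). A model $M$ over $Ag$, $S$, $Act$ and a set $AP$ of atomic propositions consists of a transition relation $T\subseteq S\times Act\times S$ (write $s\xrightarrow{a}s'$ for $(s,a,s')\in T$), initial states $I\subseteq S$, a labelling $V:S\to 2^{AP}$ and a finite set $F\subseteq 2^S$ of fairness constraints. Write $s\sim_i s'$ for $s_i=s'_i$, $img(s,a)=\{s'\mid s\xrightarrow{a}s'\}$ and $enabled(s,i)=\{a_i\mid img(s,a)\neq\emptyset\}$; it is required that $s\sim_i s'$ implies $enabled(s,i)=enabled(s',i)$. Assume that every state has an outgoing transition and that $F\neq\emptyset$. For $\Gamma\subseteq Ag$ let $enabled(s,\Gamma)=\prod_{i\in\Gamma}enabled(s,i)$; write $a_\Gamma\sqsubseteq a$ if $a\in Act$ agrees with $a_\Gamma$ on $\Gamma$. A path is an infinite sequence $\pi=s_0\xrightarrow{a_1}s_1\xrightarrow{a_2}\cdots$ of transitions, with $\pi(d)=s_d$; it is fair if it visits each $f\in F$ infinitely often. A state is fair if a fair path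 starts in it, and reachable if it lies on a path that starts in $I$. A (global, memoryless) strategy of agent $i$ is a function $f_i:S\to Act_i$ with $f_i(s)\in enabled(s,i)$ for all $s$. For a family $f_\Gamma=(f_i)_{i\in\Gamma}$ of strategies, $out(s,f_\Gamma)$ is the set of paths from $s$ with $(f_i(s_d))_{i\in\Gamma}\sqsubseteq a_{d+1}$ for all $d$. **Logic.** Formulae are built from $true$ and atoms by $\neg,\wedge,\vee$, the knowledge operators $K_i,E_\Gamma,D_\Gamma,C_\Gamma$, and the operators $Q\,X\phi$, $Q\,G\phi$, $Q(\phi_1U\phi_2)$, $Q(\phi_1W\phi_2)$ with $Q\in\{E,A,\langle\Gamma\rangle,[\Gamma]\}$. In $s\models^F_{fo}\phi$, atoms and Boolean connectives are as usual; $K_i\phi$ means that $\phi$ holds in all fair reachable $s'\sim_i s$; $E_\Gamma\phi$ means $K_i\phi$ for all $i\in\Gamma$; $D_\Gamma\phi$ means that $\phi$ holds in all fair reachable $s'$ with $s'\sim_i s$ for all $i\in\Gamma$; $C_\Gamma\phi$ means $E_\Gamma^k\phi$ for all $k\ge1$. On a path, $X,G,U$ are as usual and $\phi_1W\phi_2$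 is $(\phi_1U\phi_2)\vee G\phi_1$. $E\psi$ ($A\psi$) means that some (every) path from $s$ satisfies $\psi$; $\langle\Gamma\rangle\psi$ means that there is a family $f_\Gamma$ of strategies such that all fair paths in $out(s,f_\Gamma)$ satisfy $\psi$; and $[\Gamma]\psi$ is $\neg\langle\Gamma\rangle\neg\psi$. **Algorithm.** The set $\llbracket\phi\rrbracket^F_{fo}\subseteq S$ is defined by recursion on $\phi$. Put $$Pre_{[\Gamma]}(Z)=\{s\mid\forall a_\Gamma\in enabled(s,\Gamma)\ \exists a\sqsupseteq a_\Gamma,\ img(s,a)\cap Z\ne\emptyset\},$$ $$Pre_{\langle\Gamma\rangle}(Z)=\{s\mid\exists a_\Gamma\in enabled(s,\Gamma)\ \forall a\sqsupseteq a_\Gamma,\ img(s,a)\subseteq Z\},$$ and $Fair_{[\Gamma]}=\llbracket[\Gamma]G\,true\rrbracket$. Writing $P,P_1,P_2$ for the sets computed for $\phi,\phi_1,\phi_2$: * $\llbracket[\Gamma]X\phi\rrbracket=Pre_{[\Gamma]}(P\cap Fair_{[\Gamma]})$; * $\llbracket[\Gamma]\phi_1U\phi_2\rrbracket=\mu Z.(P_2\cap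 Fair_{[\Gamma]})\cup(P_1\cap Pre_{[\Gamma]}(Z))$; * $\llbracket[\Gamma]G\phi\rrbracket=\nu Z.P\cap\bigcap_{f\in F}Pre_{[\Gamma]}(\mu Y.(Z\cap f)\cup(P\cap Pre_{[\Gamma]}(Y)))$; * $\llbracket[\Gamma]\phi_1W\phi_2\rrbracket=\nu Z.(P_2\cap Fair_{[\Gamma]})\cup\big(P_1\cap\bigcap_{f\in F}Pre_{[\Gamma]}(\mu Y.(P_2\cap Fair_{[\Gamma]})\cup(Z\cap f)\cup(P_1\cap Pre_{[\Gamma]}(Y)))\big)$. The $\langle\Gamma\rangle$ operators are computed either by complementing the set obtained for $[\Gamma]$ on the negated path formula (with $\neg G\phi=true\,U\neg\phi$, $\neg(\phi_1U\phi_2)=\neg\phi_2W(\neg\phi_1\wedge\neg\phi_2)$, $\neg(\phi_1W\phi_2)=\neg\phi_2U(\neg\phi_1\wedge\neg\phi_2)$), or directly by the dual expressions, where $N=\overline{Fair_{[\Gamma]}}$ and $B=P_1\cup P_2\cup N$: * $\llbracket\langle\Gamma\rangle X\phi\rrbracket=Pre_{\langle\Gamma\rangle}(P\cup N)$; * $\llbracket\langle\Gamma\rangle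 G\phi\rrbracket=\nu Z.(P\cup N)\cap Pre_{\langle\Gamma\rangle}(Z)$; * $\llbracket\langle\Gamma\rangle\phi_1U\phi_2\rrbracket=\mu Z.B\cap\big(P_2\cup\bigcup_{f\in F}Pre_{\langle\Gamma\rangle}(\nu Y.B\cap(Z\cup\overline f)\cap(P_2\cup Pre_{\langle\Gamma\rangle}(Y)))\big)$; * $\llbracket\langle\Gamma\rangle\phi_1W\phi_2\rrbracket=\nu Z.B\cap(P_2\cup Pre_{\langle\Gamma\rangle}(Z))$. Boolean connectives are the set operations. With $pre_E(Z)=\{s\mid\exists a,\ img(s,a)\cap Z\neq\emptyset\}$ and $pre_A(Z)=\{s\mid\forall a,\ img(s,a)\subseteq Z\}$, the formulae $QX\phi$, $QG\phi$, $Q(\phi_1U\phi_2)$, $Q(\phi_1W\phi_2)$ with $Q\in\{E,A\}$ are computed by $pre_Q(P)$, $\nu Z.P\cap pre_Q(Z)$, $\mu Z.P_2\cup(P_1\cap pre_Q(Z))$, $\nu Z.P_2\cup(P_1\cap pre_Q(Z))$. With $R=(\mu Z.I\cup\{t\mid\exists s\in Z,\exists a,\ s\xrightarrow{a}t\})\cap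 Fair_{[\emptyset]}$, the operators $K_i$, $D_\Gamma$ are computed by $\kappa_i(P)=\overline{\{s\mid\exists t\in R\setminus P,\ t\sim_i s\}}$ and $\overline{\{s\mid\exists t\in R\setminus P\ \forall i\in\Gamma,\ t\sim_i s\}}$, and $E_\Gamma$, $C_\Gamma$ by $\varepsilon_\Gamma(P)=\bigcap_{i\in\Gamma}\kappa_i(P)$ and $\nu Z.\varepsilon_\Gamma(P\cap Z)$. **Theorem.** For every such model, every formula $\phi$ and every $s\in S$, $$s\models^F_{fo}\phi\iff s\in\llbracket\phi\rrbracket^F_{fo},$$ for both ways of computing the $\langle\Gamma\rangle$ operators. -/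

import Mathlib

namespace ATLK

universe u v w x

/-- A global state is a tuple of local states, one for each agent. -/
abbrev State {Ag : Type u} (L : Ag → Type v) : Type (max u v) := (i : Ag) → L i

/-- A joint action is a tuple of actions, one for each agent. -/
abbrev JointAction {Ag : Type u} (Act : Ag → Type w) : Type (max u w) := (i : Ag) → Act i

/-- The actions of agent `i` that occur in some transition from `s`. -/
def enabledIn {Ag : Type u} {L : Ag → Type v} {Act : Ag → Type w}
    (T : State L → JointAction Act → State L → Prop) (s : State L) (i : Ag) : Set (Act i) :=
  {b | ∃ (t : State L) (a : JointAction Act), a i = b ∧ T s a t}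

/-- Models `⟨Ag, S, Act, T, I, {∼ᵢ}, V, F⟩`. The set of states is the full product of the sets
`L i` of local states; `∼ᵢ` is equality of the local states of agent `i`. -/
structure Model (Ag : Type u) (L : Ag → Type v) (Act : Ag → Type w) (AP : Type x) where
  /-- the transition relation -/
  T : State L → JointAction Act → State L → Prop
  /-- the initial states -/
  I : Set (State L)
  /-- the labelling -/
  V : State L → Set AP
  /-- the fairness constraints -/
  F : Set (Set (State L))
  /-- there are finitely many fairness constraints -/
  finite_F : F.Finite
  /-- an agent has the same enabled actions in states which it cannot distinguish -/
  enabled_eq : ∀ (i : Ag) (s t : State L), s i = t i → enabledIn T s i = enabledIn T t i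

/-- The quantifiers in front of a path formula: the `CTL` quantifiers `E` and `A`, and the
strategic quantifiers `⟨Γ⟩` and `[Γ]`. -/
inductive Quant (Ag : Type u) : Type u
  | E : Quant Ag
  | A : Quant Ag
  | dia (Γ : Set Ag) : Quant Ag
  | box (Γ : Set Ag) : Quant Ag

/-- The formulae of the logic. A temporal operator always comes with its quantifier: for example
`glob (.box Γ) φ` is `[Γ] G φ` and `untl .E φ ψ` is `E (φ U ψ)`. -/
inductive Formula (Ag : Type u) (AP : Type x) : Type (max u x)
  | top : Formula Ag AP
  | atom (p : AP) : Formula Ag AP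
  | neg (φ : Formula Ag AP) : Formula Ag AP
  | conj (φ ψ : Formula Ag AP) : Formula Ag AP
  | disj (φ ψ : Formula Ag AP) : Formula Ag AP
  | knows (i : Ag) (φ : Formula Ag AP) : Formula Ag AP
  | everyone (Γ : Set Ag) (φ : Formula Ag AP) : Formula Ag AP
  | distributed (Γ : Set Ag) (φ : Formula Ag AP) : Formula Ag AP
  | common (Γ : Set Ag) (φ : Formula Ag AP) : Formula Ag AP
  | next (Q : Quant Ag) (φ : Formula Ag AP) : Formula Ag AP
  | glob (Q : Quant Ag) (φ : Formula Ag AP) : Formula Ag AP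
  | untl (Q : Quant Ag) (φ ψ : Formula Ag AP) : Formula Ag AP
  | weak (Q : Quant Ag) (φ ψ : Formula Ag AP) : Formula Ag AP

namespace Formula

variable {Ag : Type u} {AP : Type x}

/-- `φ → ψ`, a derived connective. -/
def imp (φ ψ : Formula Ag AP) : Formula Ag AP := disj (neg φ) ψ

/-- `F φ` under a quantifier, for example `EF φ`, `AF φ`: a derived operator. -/
def eventually (Q : Quant Ag) (φ : Formula Ag AP) : Formula Ag AP := untl Q top φ

end Formula

namespace Model

variable {Ag : Type u} {L : Ag → Type v} {Act : Ag → Type w} {AP : Type x}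
  (M : Model Ag L Act AP)

/-- `enabled(s, i)`. -/
def enabled (s : State L) (i : Ag) : Set (Act i) := enabledIn M.T s i

/-- `img(s, a)`. -/
def img (s : State L) (a : JointAction Act) : Set (State L) := {t | M.T s a t}

/-- Every state has an outgoing transition. -/
def Serial : Prop := ∀ s : State L, ∃ (a : JointAction Act) (t : State L), M.T s a t

/-- An action for every agent of the group `Γ`. -/
abbrev GroupAction (Act : Ag → Type w) (Γ : Set Ag) : Type (max u w) := (i : Γ) → Act i

/-- `b ⊑ a`: the joint action `a` completes the group action `b`. -/
def Completes {Γ : Set Ag} (b : GroupAction Act Γ) (a : JointAction Act) : Prop :=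
  ∀ i : Γ, a i = b i

/-- `enabled(s, Γ)`: every agent of the group uses one of its enabled actions. -/
def groupEnabled (s : State L) (Γ : Set Ag) : Set (GroupAction Act Γ) :=
  {b | ∀ i : Γ, b i ∈ M.enabled s i}

/-! ### Semantics -/

/-- Infinite paths `s₀ -a₁→ s₁ -a₂→ ⋯`; `act d` is the action of the step from `st d` to
`st (d + 1)`. -/
structure Path where
  /-- the states of the path -/
  st : ℕ → State L
  /-- the joint actions along the path -/
  act : ℕ → JointAction Act
  /-- consecutive states are linked by transitions -/
  step : ∀ d, M.T (st d) (act d) (st (d + 1))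

variable {M} in
/-- A path is fair if it meets every fairness constraint infinitely often. -/
def Path.Fair (π : M.Path) : Prop := ∀ f ∈ M.F, {d : ℕ | π.st d ∈ f}.Infinite

/-- A state is fair if some fair path starts in it. -/
def FairState (s : State L) : Prop := ∃ π : M.Path, π.st 0 = s ∧ π.Fair

/-- A state is reachable if it lies on a path from an initial state. -/
def Reachable (s : State L) : Prop := ∃ π : M.Path, π.st 0 ∈ M.I ∧ ∃ d, π.st d = s

/-- Global (memoryless) strategies of agent `i`. -/
def Strategy (i : Ag) : Type (max u v w) := {f : State L → Act i // ∀ s, f s ∈ M.enabled s i}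

/-- A global strategy for every agent of the group `Γ`. -/
def GroupStrategy (Γ : Set Ag) : Type (max u v w) := (i : Γ) → M.Strategy i

/-- The group action which a group strategy chooses in the state `s`. -/
def GroupStrategy.choice {M : Model Ag L Act AP} {Γ : Set Ag} (f : M.GroupStrategy Γ)
    (s : State L) : GroupAction Act Γ := fun i => (f i).1 s

/-- `out(s, f)`: the paths from `s` all of whose actions complete the choices of `f`. -/
def out {Γ : Set Ag} (s : State L) (f : M.GroupStrategy Γ) : Set M.Path :=
  {π | π.st 0 = s ∧ ∀ d, Completes (f.choice (π.st d)) (π.act d)}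

/-- `⟨Γ⟩ ψ` at `s` under full observability, for a property `ψ` of paths. -/
def Enforces (Γ : Set Ag) (s : State L) (ψ : M.Path → Prop) : Prop :=
  ∃ f : M.GroupStrategy Γ, ∀ π ∈ M.out s f, π.Fair → ψ π

/-- The meaning of the quantifiers, for a property `ψ` of paths. -/
def quantHolds (s : State L) (ψ : M.Path → Prop) : Quant Ag → Prop
  | .E => ∃ π : M.Path, π.st 0 = s ∧ ψ π
  | .A => ∀ π : M.Path, π.st 0 = s → ψ π
  | .dia Γ => M.Enforces Γ s ψ
  | .box Γ => ¬ M.Enforces Γ s (fun π => ¬ ψ π)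

/-- The path `π` stays in `P`. -/
def Path.Globally {M : Model Ag L Act AP} (π : M.Path) (P : Set (State L)) : Prop :=
  ∀ d, π.st d ∈ P

/-- The path `π` is in `P` until it is in `Q`. -/
def Path.Until {M : Model Ag L Act AP} (π : M.Path) (P Q : Set (State L)) : Prop :=
  ∃ d, π.st d ∈ Q ∧ ∀ e < d, π.st e ∈ P

/-- The states where agent `i` knows `P`: all fair reachable states which `i` cannot distinguish
from the given one are in `P`. -/
def knowsSet (i : Ag) (P : Set (State L)) : Set (State L) :=
  {s | ∀ t, t i = s i → M.Reachable t → M.FairState t → t ∈ P}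

/-- The states where every agent of `Γ` knows `P`. -/
def everyoneSet (Γ : Set Ag) (P : Set (State L)) : Set (State L) :=
  {s | ∀ i ∈ Γ, s ∈ M.knowsSet i P}

/-- The satisfaction relation `M, s ⊨ φ` under full observability and fairness. `C_Γ φ` holds if,
for every `k ≥ 1`, everyone in `Γ` knows that … (`k` times) … `φ`. -/
def Sat : Formula Ag AP → State L → Prop
  | .top, _ => True
  | .atom p, s => p ∈ M.V s
  | .neg φ, s => ¬ Sat φ s
  | .conj φ ψ, s => Sat φ s ∧ Sat ψ s
  | .disj φ ψ, s => Sat φ s ∨ Sat ψ s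
  | .knows i φ, s => s ∈ M.knowsSet i {t | Sat φ t}
  | .everyone Γ φ, s => s ∈ M.everyoneSet Γ {t | Sat φ t}
  | .distributed Γ φ, s =>
      ∀ t, (∀ i ∈ Γ, t i = s i) → M.Reachable t → M.FairState t → Sat φ t
  | .common Γ φ, s => ∀ k : ℕ, 1 ≤ k → s ∈ (M.everyoneSet Γ)^[k] {t | Sat φ t}
  | .next Q φ, s => M.quantHolds s (fun π => Sat φ (π.st 1)) Q
  | .glob Q φ, s => M.quantHolds s (fun π => π.Globally {t | Sat φ t}) Q
  | .untl Q φ ψ, s => M.quantHolds s (fun π => π.Until {t | Sat φ t} {t | Sat ψ t}) Q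
  | .weak Q φ ψ, s => M.quantHolds s
      (fun π => π.Until {t | Sat φ t} {t | Sat ψ t} ∨ π.Globally {t | Sat φ t}) Q

/-! ### The model checking algorithm -/

/-- `Pre_[Γ](Z)`: the states in which `Γ` cannot avoid to reach `Z` in one step. -/
def preBox (Γ : Set Ag) : Set (State L) →o Set (State L) where
  toFun Z := {s | ∀ b ∈ M.groupEnabled s Γ, ∃ a, Completes b a ∧ (M.img s a ∩ Z).Nonempty}
  monotone' := by
    intro Z Z' h s hs b hb
    obtain ⟨a, ha, hne⟩ := hs b hb
    exact ⟨a, ha, hne.mono (Set.inter_subset_inter_right _ h)⟩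

/-- `Pre_⟨Γ⟩(Z)`: the states in which `Γ` can enforce to reach `Z` in one step. -/
def preDia (Γ : Set Ag) : Set (State L) →o Set (State L) where
  toFun Z := {s | ∃ b ∈ M.groupEnabled s Γ, ∀ a, Completes b a → M.img s a ⊆ Z}
  monotone' := by
    rintro Z Z' h s ⟨b, hb, hs⟩
    exact ⟨b, hb, fun a ha => (hs a ha).trans h⟩

/-- `μ Y . Q ∪ (P ∩ Pre_[Γ](Y))`. -/
def reachBox (Γ : Set Ag) (P Q : Set (State L)) : Set (State L) :=
  OrderHom.lfp
    { toFun := fun Y => Q ∪ (P ∩ M.preBox Γ Y)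
      monotone' := fun _ _ h =>
        Set.union_subset_union_right _ (Set.inter_subset_inter_right _ ((M.preBox Γ).mono h)) }

theorem reachBox_mono (Γ : Set Ag) (P : Set (State L)) {Q Q' : Set (State L)} (h : Q ⊆ Q') :
    M.reachBox Γ P Q ⊆ M.reachBox Γ P Q' :=
  OrderHom.lfp.mono (fun _ => Set.union_subset_union_left _ h)

/-- `νY . Q ∩ (P ∪ Pre_⟨Γ⟩(Y))`, the dual of `reachBox`. -/
def stayDia (Γ : Set Ag) (P Q : Set (State L)) : Set (State L) :=
  OrderHom.gfp
    { toFun := fun Y => Q ∩ (P ∪ M.preDia Γ Y)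
      monotone' := fun _ _ h =>
        Set.inter_subset_inter_right _ (Set.union_subset_union_right _ ((M.preDia Γ).mono h)) }

theorem stayDia_mono (Γ : Set Ag) (P : Set (State L)) {Q Q' : Set (State L)} (h : Q ⊆ Q') :
    M.stayDia Γ P Q ⊆ M.stayDia Γ P Q' :=
  OrderHom.gfp.mono (fun _ => Set.inter_subset_inter_left _ h)

/-- `[Γ] G`:
`ν Z . P ∩ ⋂_{f ∈ F} Pre_[Γ](μ Y . (Z ∩ f) ∪ (P ∩ Pre_[Γ](Y)))`. -/
def boxG (Γ : Set Ag) (P : Set (State L)) : Set (State L) :=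
  OrderHom.gfp
    { toFun := fun Z => P ∩ ⋂ f ∈ M.F, M.preBox Γ (M.reachBox Γ P (Z ∩ f))
      monotone' := fun _ _ h => Set.inter_subset_inter_right _ (Set.iInter₂_mono fun _ _ =>
        (M.preBox Γ).mono (M.reachBox_mono Γ P (Set.inter_subset_inter_left _ h))) }

/-- `Fair_[Γ]`, which is `[Γ] G true`. -/
def fairBox (Γ : Set Ag) : Set (State L) := M.boxG Γ Set.univ

/-- `[Γ] X`: `Pre_[Γ](P ∩ Fair_[Γ])`. -/
def boxX (Γ : Set Ag) (P : Set (State L)) : Set (State L) := M.preBox Γ (P ∩ M.fairBox Γ)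

/-- `[Γ] U`: `μ Z . (Q ∩ Fair_[Γ]) ∪ (P ∩ Pre_[Γ](Z))`. -/
def boxU (Γ : Set Ag) (P Q : Set (State L)) : Set (State L) :=
  M.reachBox Γ P (Q ∩ M.fairBox Γ)

/-- `[Γ] W`: `ν Z . (Q ∩ Fair_[Γ]) ∪
(P ∩ ⋂_{f ∈ F} Pre_[Γ](μ Y . (Q ∩ Fair_[Γ]) ∪ (Z ∩ f) ∪ (P ∩ Pre_[Γ](Y))))`. -/
def boxW (Γ : Set Ag) (P Q : Set (State L)) : Set (State L) :=
  OrderHom.gfp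
    { toFun := fun Z => (Q ∩ M.fairBox Γ) ∪
        (P ∩ ⋂ f ∈ M.F, M.preBox Γ (M.reachBox Γ P ((Q ∩ M.fairBox Γ) ∪ (Z ∩ f))))
      monotone' := fun _ _ h => Set.union_subset_union_right _ (Set.inter_subset_inter_right _
        (Set.iInter₂_mono fun _ _ => (M.preBox Γ).mono (M.reachBox_mono Γ P
          (Set.union_subset_union_right _ (Set.inter_subset_inter_left _ h))))) }

/-- `⟨Γ⟩ X`, dual form: `Pre_⟨Γ⟩(P ∪ Fair_[Γ]ᶜ)`. -/
def diaX (Γ : Set Ag) (P : Set (State L)) : Set (State L) := M.preDia Γ (P ∪ (M.fairBox Γ)ᶜ)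

/-- `⟨Γ⟩ G`, dual form: `ν Z . (P ∪ Fair_[Γ]ᶜ) ∩ Pre_⟨Γ⟩(Z)`. -/
def diaG (Γ : Set Ag) (P : Set (State L)) : Set (State L) :=
  OrderHom.gfp
    { toFun := fun Z => (P ∪ (M.fairBox Γ)ᶜ) ∩ M.preDia Γ Z
      monotone' := fun _ _ h => Set.inter_subset_inter_right _ ((M.preDia Γ).mono h) }

/-- `⟨Γ⟩ U`, dual form: `μ Z . (P ∪ Q ∪ Fair_[Γ]ᶜ) ∩ (Q ∪ ⋃_{f ∈ F}
Pre_⟨Γ⟩(ν Y . (P ∪ Q ∪ Fair_[Γ]ᶜ) ∩ (Z ∪ fᶜ) ∩ (Q ∪ Pre_⟨Γ⟩(Y))))`. -/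
def diaU (Γ : Set Ag) (P Q : Set (State L)) : Set (State L) :=
  OrderHom.lfp
    { toFun := fun Z => (P ∪ Q ∪ (M.fairBox Γ)ᶜ) ∩
        (Q ∪ ⋃ f ∈ M.F, M.preDia Γ (M.stayDia Γ Q ((P ∪ Q ∪ (M.fairBox Γ)ᶜ) ∩ (Z ∪ fᶜ))))
      monotone' := fun _ _ h => Set.inter_subset_inter_right _ (Set.union_subset_union_right _
        (Set.iUnion₂_mono fun _ _ => (M.preDia Γ).mono (M.stayDia_mono Γ Q
          (Set.inter_subset_inter_right _ (Set.union_subset_union_left _ h))))) }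

/-- `⟨Γ⟩ W`, dual form: `ν Z . (P ∪ Q ∪ Fair_[Γ]ᶜ) ∩ (Q ∪ Pre_⟨Γ⟩(Z))`. -/
def diaW (Γ : Set Ag) (P Q : Set (State L)) : Set (State L) :=
  M.stayDia Γ Q (P ∪ Q ∪ (M.fairBox Γ)ᶜ)

/-- `EX`: the states with a successor in `Z`. -/
def preE : Set (State L) →o Set (State L) where
  toFun Z := {s | ∃ a, (M.img s a ∩ Z).Nonempty}
  monotone' := by
    rintro Z Z' h s ⟨a, hne⟩
    exact ⟨a, hne.mono (Set.inter_subset_inter_right _ h)⟩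

/-- `AX`: the states all of whose successors are in `Z`. -/
def preA : Set (State L) →o Set (State L) where
  toFun Z := {s | ∀ a, M.img s a ⊆ Z}
  monotone' := fun _ _ h _ hs a => (hs a).trans h

/-- `μ Z . Q ∪ (P ∩ pre(Z))`, the algorithm for `EU` and `AU`. -/
def ctlU (pre : Set (State L) →o Set (State L)) (P Q : Set (State L)) : Set (State L) :=
  OrderHom.lfp
    { toFun := fun Z => Q ∪ (P ∩ pre Z)
      monotone' := fun _ _ h =>
        Set.union_subset_union_right _ (Set.inter_subset_inter_right _ (pre.mono h)) }

/-- `ν Z . Q ∪ (P ∩ pre(Z))`, the algorithm for `EW` and `AW`. -/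
def ctlW (pre : Set (State L) →o Set (State L)) (P Q : Set (State L)) : Set (State L) :=
  OrderHom.gfp
    { toFun := fun Z => Q ∪ (P ∩ pre Z)
      monotone' := fun _ _ h =>
        Set.union_subset_union_right _ (Set.inter_subset_inter_right _ (pre.mono h)) }

/-- `ν Z . P ∩ pre(Z)`, the algorithm for `EG` and `AG`. -/
def ctlG (pre : Set (State L) →o Set (State L)) (P : Set (State L)) : Set (State L) :=
  OrderHom.gfp
    { toFun := fun Z => P ∩ pre Z
      monotone' := fun _ _ h => Set.inter_subset_inter_right _ (pre.mono h) }

/-- The computed set of reachable states: `μ Z . I ∪ Post(Z)`. -/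
def reachSet : Set (State L) :=
  OrderHom.lfp
    { toFun := fun Z => M.I ∪ {t | ∃ s ∈ Z, ∃ a, M.T s a t}
      monotone' := fun _ _ h => Set.union_subset_union_right _ (by
        rintro t ⟨s, hs, a, ha⟩
        exact ⟨s, h hs, a, ha⟩) }

/-- The computed set of fair reachable states: `Fair_[∅]` is the set of the fair states. -/
def fairReach : Set (State L) := M.reachSet ∩ M.fairBox ∅

/-- The algorithm for `K_i`. -/
def evalK (i : Ag) (P : Set (State L)) : Set (State L) :=
  {s | ∃ t ∈ M.fairReach ∩ Pᶜ, t i = s i}ᶜ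

/-- The algorithm for `E_Γ`. -/
def evalE (Γ : Set Ag) (P : Set (State L)) : Set (State L) := ⋂ i ∈ Γ, M.evalK i P

/-- The algorithm for `D_Γ`. -/
def evalD (Γ : Set Ag) (P : Set (State L)) : Set (State L) :=
  {s | ∃ t ∈ M.fairReach ∩ Pᶜ, ∀ i ∈ Γ, t i = s i}ᶜ

theorem evalE_mono (Γ : Set Ag) {P P' : Set (State L)} (h : P ⊆ P') :
    M.evalE Γ P ⊆ M.evalE Γ P' :=
  Set.iInter₂_mono fun i _ => Set.compl_subset_compl.mpr (by
    rintro s ⟨t, ⟨ht, ht'⟩, he⟩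
    exact ⟨t, ⟨ht, fun hp => ht' (h hp)⟩, he⟩)

/-- The algorithm for `C_Γ`: `ν Z . E_Γ(P ∩ Z)`. -/
def evalC (Γ : Set Ag) (P : Set (State L)) : Set (State L) :=
  OrderHom.gfp
    { toFun := fun Z => M.evalE Γ (P ∩ Z)
      monotone' := fun _ _ h => M.evalE_mono Γ (Set.inter_subset_inter_right _ h) }

/-- The two ways in which the algorithm may treat `⟨Γ⟩`: by complementing the result for `[Γ]` on
the negated path formula, or directly by the dual fix point expressions. -/
inductive DiaMode : Type
  | viaBox : DiaMode
  | direct : DiaMode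

/-- The algorithm for `X` under a quantifier. -/
def evalX (P : Set (State L)) : DiaMode → Quant Ag → Set (State L)
  | _, .E => M.preE P
  | _, .A => M.preA P
  | _, .box Γ => M.boxX Γ P
  | .direct, .dia Γ => M.diaX Γ P
  | .viaBox, .dia Γ => (M.boxX Γ Pᶜ)ᶜ

/-- The algorithm for `G` under a quantifier; `¬ G P` is `true U ¬ P`. -/
def evalG (P : Set (State L)) : DiaMode → Quant Ag → Set (State L)
  | _, .E => ctlG M.preE P
  | _, .A => ctlG M.preA P
  | _, .box Γ => M.boxG Γ P
  | .direct, .dia Γ => M.diaG Γ P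
  | .viaBox, .dia Γ => (M.boxU Γ Set.univ Pᶜ)ᶜ

/-- The algorithm for `U` under a quantifier; `¬ (P U Q)` is `¬ Q W (¬ P ∧ ¬ Q)`. -/
def evalU (P Q : Set (State L)) : DiaMode → Quant Ag → Set (State L)
  | _, .E => ctlU M.preE P Q
  | _, .A => ctlU M.preA P Q
  | _, .box Γ => M.boxU Γ P Q
  | .direct, .dia Γ => M.diaU Γ P Q
  | .viaBox, .dia Γ => (M.boxW Γ Qᶜ (Pᶜ ∩ Qᶜ))ᶜ

/-- The algorithm for `W` under a quantifier; `¬ (P W Q)` is `¬ Q U (¬ P ∧ ¬ Q)`. -/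
def evalW (P Q : Set (State L)) : DiaMode → Quant Ag → Set (State L)
  | _, .E => ctlW M.preE P Q
  | _, .A => ctlW M.preA P Q
  | _, .box Γ => M.boxW Γ P Q
  | .direct, .dia Γ => M.diaW Γ P Q
  | .viaBox, .dia Γ => (M.boxU Γ Qᶜ (Pᶜ ∩ Qᶜ))ᶜ

/-- The set `⟦φ⟧` of states which the model checking algorithm returns. -/
def eval (m : DiaMode) : Formula Ag AP → Set (State L)
  | .top => Set.univ
  | .atom p => {s | p ∈ M.V s}
  | .neg φ => (eval m φ)ᶜ
  | .conj φ ψ => eval m φ ∩ eval m ψ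
  | .disj φ ψ => eval m φ ∪ eval m ψ
  | .knows i φ => M.evalK i (eval m φ)
  | .everyone Γ φ => M.evalE Γ (eval m φ)
  | .distributed Γ φ => M.evalD Γ (eval m φ)
  | .common Γ φ => M.evalC Γ (eval m φ)
  | .next Q φ => M.evalX (eval m φ) m Q
  | .glob Q φ => M.evalG (eval m φ) m Q
  | .untl Q φ ψ => M.evalU (eval m φ) (eval m ψ) m Q
  | .weak Q φ ψ => M.evalW (eval m φ) (eval m ψ) m Q

end Model

end ATLK

namespace ATLK

open Relation

/-! ### Fixed points -/

/-! By structural induction each case reduces to the correctness of one operator on arbitrary sets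
of states. The substantial cases are those of `[Γ]`: by De Morgan duality of fixed points the direct
expressions for `⟨Γ⟩` equal the complements used in the other mode, and `A` is likewise the dual of
`E`.

Soundness for `[Γ]`: fix a strategy of the group. Membership in `Pre_[Γ]` yields a compatible
successor, so membership in the inner least fixed point yields a compatible finite path. In the
greatest fixed point, each fairness constraint can thus be reached by a nonempty path that ends in
the fixed point again, unless the goal of the until is reached. Serving the constraints in an order
in which each recurs infinitely often, and joining the finite paths, gives a fair run
(`exists_fair_run`, `exists_of_mem_weakBox`).

Completeness: outside the computed set the group needs one memoryless strategy that defeats all fair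
paths. For the nested fixed points, rank a state by the lexicographically least pair of an ordinal
stage of the outer least fixed point and the index of a constraint to be avoided; the strategy
forces the inner set belonging to that pair. Along a run the rank cannot increase, so it is finally
constant, and from then on its constraint is avoided (`exists_target_of_forceDia`). Ordinals are
needed because the state space may be infinite.

The sets `Fair_[Γ]` are handled by gluing: outside `Fair_[Γ]` the group plays to destroy fairness,
inside it plays for the operator at hand. A fair run of the glued strategy never leaves `Fair_[Γ]`
(`Serial.exists_strategy_fair`), so intersecting with that set loses nothing. -/

theorem compl_lfp_eq_gfp {α : Type*} {f g : Set α →o Set α} (h : ∀ Z, (f Z)ᶜ = g Zᶜ) :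
    f.lfpᶜ = g.gfp := by
  apply le_antisymm
  · apply g.le_gfp
    rw [← h, f.map_lfp]
  · rw [Set.subset_compl_comm]
    apply f.lfp_le
    rw [← Set.compl_subset_compl, h, compl_compl, g.map_gfp]

theorem compl_gfp_eq_lfp {α : Type*} {f g : Set α →o Set α} (h : ∀ Z, (f Z)ᶜ = g Zᶜ) :
    f.gfpᶜ = g.lfp := by
  rw [← compl_lfp_eq_gfp (f := g) (g := f), compl_compl]
  intro Z
  rw [← compl_compl (f Zᶜ), h, compl_compl]

/-- An element of the least fixed point enters it at some ordinal stage. -/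
theorem exists_mem_lfpApprox_of_mem_lfp {α : Type u} (f : Set α →o Set α) {x : α}
    (hx : x ∈ f.lfp) : ∃ a : Ordinal.{u}, x ∈ OrdinalApprox.lfpApprox f ⊥ a := by
  obtain ⟨a, ha⟩ := OrdinalApprox.lfp_mem_range_lfpApprox f
  exact ⟨a, by rw [ha]; exact hx⟩

/-- A stage is the union of the images of the earlier stages. The strict decrease from `a` to `b` is
what makes the ordinal usable as a rank. -/
theorem exists_mem_apply_lfpApprox {α : Type u} (f : Set α →o Set α) {x : α} {a : Ordinal.{u}}
    (hx : x ∈ OrdinalApprox.lfpApprox f ⊥ a) :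
    ∃ b < a, x ∈ f (OrdinalApprox.lfpApprox f ⊥ b) := by
  rw [OrdinalApprox.lfpApprox] at hx
  simpa using hx

theorem lfpApprox_subset_lfp {α : Type u} (f : Set α →o Set α) (a : Ordinal.{u}) :
    OrdinalApprox.lfpApprox f ⊥ a ⊆ f.lfp :=
  OrdinalApprox.lfpApprox_le_of_mem_fixedPoints f f.map_lfp bot_le a

/-! ### Runs of a relation -/

section Runs

variable {α : Type*} {r : α → α → Prop} {u : ℕ → α} {P Q : Set α}

/-- Infinite runs of a relation. -/
def IsRun (r : α → α → Prop) (u : ℕ → α) : Prop := ∀ d, r (u d) (u (d + 1))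

/-- The sequence `u` with `x` in front. -/
def consSeq (x : α) (u : ℕ → α) : ℕ → α
  | 0 => x
  | n + 1 => u n

/-- The sequence `u` is in `P` until it is in `Q`. -/
def SeqUntil (u : ℕ → α) (P Q : Set α) : Prop := ∃ d, u d ∈ Q ∧ ∀ e < d, u e ∈ P

/-- The sequence `u` meets each of the sets in `F` infinitely often. -/
def SeqFair (F : Set (Set α)) (u : ℕ → α) : Prop := ∀ f ∈ F, {d : ℕ | u d ∈ f}.Infinite

theorem IsRun.cons {x : α} (hu : IsRun r u) (hx : r x (u 0)) : IsRun r (consSeq x u)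
  | 0 => hx
  | d + 1 => hu d

theorem IsRun.shift (hu : IsRun r u) (m : ℕ) : IsRun r (fun d => u (m + d)) :=
  fun d => hu (m + d)

theorem SeqUntil.cons {x : α} (hu : SeqUntil u P Q) (hx : x ∈ P) :
    SeqUntil (consSeq x u) P Q := by
  obtain ⟨d, hd, hlt⟩ := hu
  refine ⟨d + 1, hd, fun e he => ?_⟩
  cases e with
  | zero => exact hx
  | succ e => exact hlt e (by lia)

theorem SeqFair.cons {F : Set (Set α)} (x : α) (hu : SeqFair F u) :
    SeqFair F (consSeq x u) := fun f hf =>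
  ((hu f hf).image Nat.succ_injective.injOn).mono (by
    rintro _ ⟨d, hd, rfl⟩
    exact hd)

theorem SeqFair.shift {F : Set (Set α)} (hu : SeqFair F u) (m : ℕ) :
    SeqFair F (fun d => u (m + d)) := by
  intro f hf
  rw [Set.infinite_iff_exists_gt]
  intro n
  obtain ⟨d, hd, hlt⟩ := (hu f hf).exists_gt (m + n)
  refine ⟨d - m, ?_, by lia⟩
  have : m + (d - m) = d := by lia
  simpa [this] using hd

/-- A set which contains `Q` and is closed under predecessors in `P` contains the start of each
run which is in `P` until it is in `Q`. -/
theorem SeqUntil.mem_of_closed {S : Set α} (hQ : Q ⊆ S)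
    (hP : ∀ x ∈ P, ∀ y ∈ S, r x y → x ∈ S) (hu : IsRun r u) (h : SeqUntil u P Q) : u 0 ∈ S := by
  obtain ⟨d, hd, hlt⟩ := h
  have key : ∀ k ≤ d, u (d - k) ∈ S := by
    intro k
    induction k with
    | zero => exact fun _ => hQ hd
    | succ k ih =>
      intro hk
      refine hP _ (hlt _ (by lia)) _ (ih (by lia)) ?_
      have : d - k = d - (k + 1) + 1 := by lia
      rw [this]
      exact hu _
  simpa using key d le_rfl

/-- A total relation has runs which move into a prescribed set whenever they can. -/
theorem exists_run_of_total (hr : ∀ x, ∃ y, r x y) (Z : α → Set α) (x : α) :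
    ∃ u, u 0 = x ∧ IsRun r u ∧ ∀ d, (∃ y ∈ Z (u d), r (u d) y) → u (d + 1) ∈ Z (u d) := by
  have h : ∀ x, ∃ y, r x y ∧ ((∃ y ∈ Z x, r x y) → y ∈ Z x) := by
    intro x
    by_cases hx : ∃ y ∈ Z x, r x y
    · obtain ⟨y, hy, hxy⟩ := hx
      exact ⟨y, hxy, fun _ => hy⟩
    · obtain ⟨y, hxy⟩ := hr x
      exact ⟨y, hxy, fun h => absurd h hx⟩
  choose g hg hZ using h
  refine ⟨fun n => g^[n] x, rfl, fun d => ?_, fun d => ?_⟩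
  · simp only [Function.iterate_succ_apply']
    exact hg _
  · simp only [Function.iterate_succ_apply']
    exact hZ _

/-! ### Negations of path properties -/

theorem not_forall_mem_iff_seqUntil : ¬ (∀ d, u d ∈ P) ↔ SeqUntil u Set.univ Pᶜ := by
  simp [SeqUntil]

/-- If `Q` ever holds, look at its first occurrence: `P` must fail strictly before it, at a moment
when `Q` has not yet held. -/
theorem not_seqUntil_iff :
    ¬ SeqUntil u P Q ↔ SeqUntil u Qᶜ (Pᶜ ∩ Qᶜ) ∨ ∀ d, u d ∈ Qᶜ := by
  constructor
  · intro h
    by_cases hQ : ∀ d, u d ∈ Qᶜ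
    · exact Or.inr hQ
    · left
      classical
      push Not at hQ
      have hm := Nat.find_spec hQ
      have hlt : ∀ e < Nat.find hQ, u e ∈ Qᶜ := fun e he => not_not.mp (Nat.find_min hQ he)
      by_contra hn
      refine h ⟨Nat.find hQ, not_not.mp hm, fun e he => ?_⟩
      by_contra hP
      exact hn ⟨e, ⟨hP, hlt e he⟩, fun e' he' => hlt e' (he'.trans he)⟩
  · rintro (⟨d, ⟨hP, hQ⟩, hlt⟩ | h) ⟨e, he, hlt'⟩
    · rcases lt_trichotomy d e with hde | rfl | hde
      · exact hP (hlt' d hde)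
      · exact hQ he
      · exact hlt e hde he
    · exact h e he

theorem not_seqUntil_or_forall_iff :
    ¬ (SeqUntil u P Q ∨ ∀ d, u d ∈ P) ↔ SeqUntil u Qᶜ (Pᶜ ∩ Qᶜ) := by
  rw [not_or, not_seqUntil_iff]
  constructor
  · rintro ⟨h | h, hP⟩
    · exact h
    · push Not at hP
      obtain ⟨d, hd⟩ := hP
      exact ⟨d, ⟨hd, h d⟩, fun e _ => h e⟩
  · intro h
    refine ⟨Or.inl h, fun hP => ?_⟩
    obtain ⟨d, hd, -⟩ := h
    exact hd.1 (hP d)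

/-- Chains of length `n + 1`. -/
def StepIn (r : α → α → Prop) : ℕ → α → α → Prop
  | 0, x, y => r x y
  | n + 1, x, y => ∃ z, r x z ∧ StepIn r n z y

theorem exists_stepIn_of_transGen {x y : α} (h : TransGen r x y) : ∃ n, StepIn r n x y := by
  induction h using TransGen.head_induction_on with
  | single h => exact ⟨0, h⟩
  | head h _ ih =>
    obtain ⟨n, hn⟩ := ih
    exact ⟨n + 1, _, h, hn⟩

/-- Finite chains which link the members of a sequence can be joined to an infinite run. -/
theorem exists_run_through (hu : ∀ n, TransGen r (u n) (u (n + 1))) :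
    ∃ v : ℕ → α, v 0 = u 0 ∧ IsRun r v ∧ ∀ n, ∃ d ≥ n, v d = u n := by
  choose k hk using fun n => exists_stepIn_of_transGen (hu n)
  -- A node `(n, j, x)` is a position `x` on the way from `u n` to `u (n + 1)`, with `j + 1` steps
  -- still to go. Each move shortens the remaining chain or, at its end, starts the next one.
  let Node := {p : ℕ × ℕ × α // StepIn r p.2.1 p.2.2 (u (p.1 + 1))}
  have hnext : ∀ p : Node, ∃ q : Node, r p.1.2.2 q.1.2.2 ∧
      ((p.1.2.1 = 0 ∧ q.1.1 = p.1.1 + 1 ∧ q.1.2.2 = u (p.1.1 + 1)) ∨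
        (p.1.2.1 = q.1.2.1 + 1 ∧ q.1.1 = p.1.1)) := by
    rintro ⟨⟨n, j, x⟩, hp⟩
    cases j with
    | zero => exact ⟨⟨⟨n + 1, k (n + 1), u (n + 1)⟩, hk _⟩, hp, Or.inl ⟨rfl, rfl, rfl⟩⟩
    | succ j =>
      obtain ⟨z, hz, hj⟩ := hp
      exact ⟨⟨⟨n, j, z⟩, hj⟩, hz, Or.inr ⟨rfl, rfl⟩⟩
  choose g hg hstep using hnext
  let N : ℕ → Node := fun d => g^[d] ⟨⟨0, k 0, u 0⟩, hk 0⟩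
  have hN : ∀ d, N (d + 1) = g (N d) := fun d => Function.iterate_succ_apply' _ _ _
  -- Induction on the remaining length: the current chain is finished after finitely many moves.
  have adv : ∀ j d, (N d).1.2.1 = j →
      ∃ e > d, (N e).1.1 = (N d).1.1 + 1 ∧ (N e).1.2.2 = u ((N d).1.1 + 1) := by
    intro j
    induction j with
    | zero =>
      intro d hd
      rcases hstep (N d) with ⟨-, h1, h2⟩ | ⟨h, -⟩
      · exact ⟨d + 1, by lia, by rw [hN, h1], by rw [hN, h2]⟩
      · lia
    | succ j ih =>
      intro d hd
      rcases hstep (N d) with ⟨h, -⟩ | ⟨h1, h2⟩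
      · lia
      · obtain ⟨e, he, h3, h4⟩ := ih (d + 1) (by rw [hN]; lia)
        rw [hN, h2] at h3 h4
        exact ⟨e, by lia, h3, h4⟩
  refine ⟨fun d => (N d).1.2.2, rfl, fun d => by simpa only [hN] using hg (N d), fun n => ?_⟩
  have : ∃ d ≥ n, (N d).1.1 = n ∧ (N d).1.2.2 = u n := by
    induction n with
    | zero => exact ⟨0, le_rfl, rfl, rfl⟩
    | succ n ih =>
      obtain ⟨d, hd, h1, -⟩ := ih
      obtain ⟨e, he, h3, h4⟩ := adv _ d rfl
      rw [h1] at h3 h4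
      exact ⟨e, by lia, h3, h4⟩
  obtain ⟨d, hd, -, h⟩ := this
  exact ⟨d, hd, h⟩

/-- A run which meets each set of a nonempty countable family infinitely often exists if from
`Z` one can always come back to `Z` within each of these sets. -/
theorem exists_fair_run {F : Set (Set α)} (hF : F.Nonempty) (hc : F.Countable) {Z : Set α}
    (h : ∀ x ∈ Z, ∀ f ∈ F, ∃ y ∈ Z ∩ f, TransGen r x y) {x : α} (hx : x ∈ Z) :
    ∃ u, u 0 = x ∧ IsRun r u ∧ SeqFair F u := by
  obtain ⟨e, rfl⟩ := hc.exists_eq_range hF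
  -- The first component of `unpair` takes each value infinitely often, so round `n` can serve
  -- constraint `n.unpair.1` and every constraint recurs.
  have hnext : ∀ (n : ℕ) (p : Z), ∃ q : Z, q.1 ∈ e n.unpair.1 ∧ TransGen r p.1 q.1 := by
    intro n p
    obtain ⟨y, hy, hr⟩ := h p.1 p.2 (e n.unpair.1) ⟨_, rfl⟩
    exact ⟨⟨y, hy.1⟩, hy.2, hr⟩
  choose g hg hr using hnext
  let w : ℕ → Z := fun n => Nat.rec ⟨x, hx⟩ (fun n p => g n p) n
  obtain ⟨v, hv0, hv, hvw⟩ := exists_run_through (u := fun n => (w n).1)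
    (fun n => hr n (w n))
  refine ⟨v, hv0, hv, ?_⟩
  rintro _ ⟨i, rfl⟩
  rw [Set.infinite_iff_exists_gt]
  intro n
  -- Round `k` produces the point with index `k + 1`, hence the shift; `Nat.pair i n ≥ n` puts the
  -- visit beyond `n`.
  obtain ⟨d, hd, hvd⟩ := hvw (Nat.pair i n + 1)
  refine ⟨d, ?_, ?_⟩
  · have := hg (Nat.pair i n) (w (Nat.pair i n))
    rw [Nat.unpair_pair] at this
    rw [Set.mem_ofPred_eq, hvd]
    exact this
  · have := Nat.right_le_pair i n
    lia

end Runs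

end ATLK

namespace ATLK

open Relation

namespace Model

variable {Ag : Type u} {L : Ag → Type v} {Act : Ag → Type w} {AP : Type x}
  (M : Model Ag L Act AP)

/-! ### Paths, runs and strategies -/

/-- Transitions by some joint action. -/
def Succ (s t : State L) : Prop := ∃ a, M.T s a t

variable {M} in
/-- Transitions which are compatible with a group strategy. -/
def GroupStrategy.Succ {Γ : Set Ag} (σ : M.GroupStrategy Γ) (s t : State L) : Prop :=
  ∃ a, Completes (σ.choice s) a ∧ M.T s a t

theorem Path.isRun (π : M.Path) : IsRun M.Succ π.st := fun d => ⟨_, π.step d⟩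

theorem exists_path_of_isRun {u : ℕ → State L} (hu : IsRun M.Succ u) :
    ∃ π : M.Path, π.st = u := by
  choose a ha using hu
  exact ⟨⟨u, a, ha⟩, rfl⟩

variable {M}

theorem isRun_of_mem_out {Γ : Set Ag} {σ : M.GroupStrategy Γ} {s : State L} {π : M.Path}
    (h : π ∈ M.out s σ) : IsRun σ.Succ π.st := fun d => ⟨_, h.2 d, π.step d⟩

theorem exists_mem_out_of_isRun {Γ : Set Ag} {σ : M.GroupStrategy Γ} {u : ℕ → State L}
    (hu : IsRun σ.Succ u) : ∃ π ∈ M.out (u 0) σ, π.st = u := by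
  choose a ha using hu
  exact ⟨⟨u, a, fun d => (ha d).2⟩, ⟨rfl, fun d => (ha d).1⟩, rfl⟩

variable (M) in
/-- Semantics of `[Γ]` for a property of the sequence of states of a path. -/
theorem quantHolds_box {Γ : Set Ag} {s : State L} {ψ : M.Path → Prop} (p : (ℕ → State L) → Prop)
    (hp : ∀ π : M.Path, ψ π ↔ p π.st) :
    M.quantHolds s ψ (.box Γ) ↔ ∀ σ : M.GroupStrategy Γ, ∃ u, u 0 = s ∧ IsRun σ.Succ u ∧
      SeqFair M.F u ∧ p u := by
  simp only [quantHolds, Enforces, not_exists, not_forall, not_not, exists_prop]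
  refine forall_congr' fun σ => ⟨?_, ?_⟩
  · rintro ⟨π, hπ, hf, h⟩
    exact ⟨π.st, hπ.1, isRun_of_mem_out hπ, hf, (hp π).mp h⟩
  · rintro ⟨u, rfl, hu, hf, h⟩
    obtain ⟨π, hπ, rfl⟩ := exists_mem_out_of_isRun hu
    exact ⟨π, hπ, hf, (hp π).mpr h⟩

variable (M) in
/-- Semantics of `E` for a property of the sequence of states of a path. -/
theorem quantHolds_E {s : State L} {ψ : M.Path → Prop} (p : (ℕ → State L) → Prop)
    (hp : ∀ π : M.Path, ψ π ↔ p π.st) :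
    M.quantHolds s ψ .E ↔ ∃ u, u 0 = s ∧ IsRun M.Succ u ∧ p u := by
  constructor
  · rintro ⟨π, hπ, h⟩
    exact ⟨π.st, hπ, π.isRun, (hp π).mp h⟩
  · rintro ⟨u, rfl, hu, h⟩
    obtain ⟨π, rfl⟩ := M.exists_path_of_isRun hu
    exact ⟨π, rfl, (hp π).mpr h⟩

theorem quantHolds_A {s : State L} {ψ : M.Path → Prop} :
    M.quantHolds s ψ .A ↔ ¬ M.quantHolds s (fun π => ¬ ψ π) .E := by
  simp [quantHolds]

theorem quantHolds_dia {Γ : Set Ag} {s : State L} {ψ : M.Path → Prop} :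
    M.quantHolds s ψ (.dia Γ) ↔ ¬ M.quantHolds s (fun π => ¬ ψ π) (.box Γ) := by
  simp [quantHolds]

theorem Serial.succ (h : M.Serial) (s : State L) : ∃ t, M.Succ s t := by
  obtain ⟨a, t, ht⟩ := h s
  exact ⟨t, a, ht⟩

theorem mem_preBox_iff {Γ : Set Ag} {Z : Set (State L)} {s : State L} :
    s ∈ M.preBox Γ Z ↔
      ∀ b ∈ M.groupEnabled s Γ, ∃ a, Completes b a ∧ (M.img s a ∩ Z).Nonempty := Iff.rfl

theorem mem_preDia_iff {Γ : Set Ag} {Z : Set (State L)} {s : State L} :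
    s ∈ M.preDia Γ Z ↔
      ∃ b ∈ M.groupEnabled s Γ, ∀ a, Completes b a → M.img s a ⊆ Z := Iff.rfl

theorem compl_preBox (Γ : Set Ag) (Z : Set (State L)) : (M.preBox Γ Z)ᶜ = M.preDia Γ Zᶜ := by
  ext s
  rw [Set.mem_compl_iff, mem_preBox_iff, mem_preDia_iff]
  simp only [Set.not_nonempty_iff_eq_empty, not_forall, not_exists, not_and, exists_prop,
    ← Set.disjoint_iff_inter_eq_empty, Set.subset_compl_iff_disjoint_right]

theorem compl_preE (Z : Set (State L)) : (M.preE Z)ᶜ = M.preA Zᶜ := by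
  ext s
  change (¬ ∃ a, (M.img s a ∩ Z).Nonempty) ↔ ∀ a, M.img s a ⊆ Zᶜ
  simp only [Set.not_nonempty_iff_eq_empty, not_exists,
    ← Set.disjoint_iff_inter_eq_empty, Set.subset_compl_iff_disjoint_right]

theorem mem_preE_iff {Z : Set (State L)} {s : State L} :
    s ∈ M.preE Z ↔ ∃ t ∈ Z, M.Succ s t := by
  constructor
  · rintro ⟨a, t, ht, hZ⟩
    exact ⟨t, hZ, a, ht⟩
  · rintro ⟨t, hZ, a, ht⟩
    exact ⟨a, t, ht, hZ⟩

theorem exists_succ_of_mem_preBox {Γ : Set Ag} (σ : M.GroupStrategy Γ) {Z : Set (State L)}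
    {s : State L} (h : s ∈ M.preBox Γ Z) : ∃ t ∈ Z, σ.Succ s t := by
  obtain ⟨a, ha, t, ht, hZ⟩ := h (σ.choice s) fun i => (σ i).2 s
  exact ⟨t, hZ, a, ha, ht⟩

/-- A group has a memoryless strategy which forces the next state into a prescribed set
wherever it can do so. -/
theorem Serial.exists_strategy (h : M.Serial) (Γ : Set Ag) (Z : State L → Set (State L)) :
    ∃ σ : M.GroupStrategy Γ, ∀ s, s ∈ M.preDia Γ (Z s) → ∀ t, σ.Succ s t → t ∈ Z s := by
  have hb : ∀ s, ∃ b : GroupAction Act Γ, b ∈ M.groupEnabled s Γ ∧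
      (s ∈ M.preDia Γ (Z s) → ∀ a, Completes b a → M.img s a ⊆ Z s) := by
    intro s
    by_cases hs : s ∈ M.preDia Γ (Z s)
    · obtain ⟨b, hb, hZ⟩ := hs
      exact ⟨b, hb, fun _ => hZ⟩
    -- Where nothing can be forced, any transition supplies an enabled action for each agent.
    · obtain ⟨a, t, ht⟩ := h s
      exact ⟨fun i => a i, fun i => ⟨t, a, rfl, ht⟩, fun h => absurd h hs⟩
  choose b hb hZ using hb
  -- Every agent observes the whole state, so the choices made state by state combine into
  -- individual strategies.
  refine ⟨fun i => ⟨fun s => b s i, fun s => hb s i⟩, fun s hs t => ?_⟩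
  rintro ⟨a, ha, ht⟩
  exact hZ s hs a ha ht

/-! ### Reachability and weak until against all strategies -/

theorem reachBox_eq (Γ : Set Ag) (P Q : Set (State L)) :
    M.reachBox Γ P Q = Q ∪ (P ∩ M.preBox Γ (M.reachBox Γ P Q)) :=
  (OrderHom.map_lfp _).symm

theorem reachBox_subset {Γ : Set Ag} {P Q Z : Set (State L)} (hQ : Q ⊆ Z)
    (hP : P ∩ M.preBox Γ Z ⊆ Z) : M.reachBox Γ P Q ⊆ Z :=
  OrderHom.lfp_le _ (Set.union_subset hQ hP)

theorem stayDia_eq (Γ : Set Ag) (P Q : Set (State L)) :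
    M.stayDia Γ P Q = Q ∩ (P ∪ M.preDia Γ (M.stayDia Γ P Q)) :=
  (OrderHom.map_gfp _).symm

theorem compl_reachBox (Γ : Set Ag) (P Q : Set (State L)) :
    (M.reachBox Γ P Q)ᶜ = M.stayDia Γ Pᶜ Qᶜ := by
  refine compl_lfp_eq_gfp fun Z => ?_
  change (Q ∪ (P ∩ M.preBox Γ Z))ᶜ = Qᶜ ∩ (Pᶜ ∪ M.preDia Γ Zᶜ)
  rw [Set.compl_union, Set.compl_inter, compl_preBox]

/-- From a state of `reachBox` each strategy has a compatible finite path in `P` to `Q`. -/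
theorem exists_reflTransGen_of_mem_reachBox {Γ : Set Ag} (σ : M.GroupStrategy Γ)
    {P Q : Set (State L)} {s : State L} (hs : s ∈ M.reachBox Γ P Q) :
    ∃ t ∈ Q, ReflTransGen (fun x y => x ∈ P ∧ σ.Succ x y) s t := by
  refine reachBox_subset (Z := {s | ∃ t ∈ Q, ReflTransGen (fun x y => x ∈ P ∧ σ.Succ x y) s t})
    (fun t ht => ⟨t, ht, .refl⟩) ?_ hs
  clear hs s
  rintro s ⟨hP, hs⟩
  obtain ⟨y, ⟨t, ht, hyt⟩, hsy⟩ := exists_succ_of_mem_preBox σ hs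
  exact ⟨t, ht, hyt.head ⟨hP, hsy⟩⟩

variable (M) in
/-- The states from which no strategy of `Γ` can prevent that `P` holds until `R` is reached, or
that `P` holds forever on a fair path. -/
def weakBox (Γ : Set Ag) (P R : Set (State L)) : Set (State L) :=
  OrderHom.gfp
    { toFun := fun Z => R ∪ (P ∩ ⋂ f ∈ M.F, M.preBox Γ (M.reachBox Γ P (R ∪ (Z ∩ f))))
      monotone' := fun _ _ h => Set.union_subset_union_right _ (Set.inter_subset_inter_right _
        (Set.iInter₂_mono fun _ _ => (M.preBox Γ).mono (M.reachBox_mono Γ P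
          (Set.union_subset_union_right _ (Set.inter_subset_inter_left _ h))))) }

variable (M) in
/-- The complement of `weakBox`, up to complements of the arguments. -/
def forceDia (Γ : Set Ag) (P B : Set (State L)) : Set (State L) :=
  OrderHom.lfp
    { toFun := fun Z => B ∩ (P ∪ ⋃ f ∈ M.F, M.preDia Γ (M.stayDia Γ P (B ∩ (Z ∪ fᶜ))))
      monotone' := fun _ _ h => Set.inter_subset_inter_right _ (Set.union_subset_union_right _
        (Set.iUnion₂_mono fun _ _ => (M.preDia Γ).mono (M.stayDia_mono Γ P
          (Set.inter_subset_inter_right _ (Set.union_subset_union_left _ h))))) }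

/-- With an unreachable goal, weak until degenerates to `G`; so one argument about `weakBox` covers
`G`, `W` and `Fair_[Γ]`. -/
theorem boxG_eq_weakBox (Γ : Set Ag) (P : Set (State L)) : M.boxG Γ P = M.weakBox Γ P ∅ := by
  unfold boxG weakBox
  simp only [Set.empty_union]

theorem boxW_eq_weakBox (Γ : Set Ag) (P Q : Set (State L)) :
    M.boxW Γ P Q = M.weakBox Γ P (Q ∩ M.fairBox Γ) := rfl

theorem diaU_eq_forceDia (Γ : Set Ag) (P Q : Set (State L)) :
    M.diaU Γ P Q = M.forceDia Γ Q (P ∪ Q ∪ (M.fairBox Γ)ᶜ) := rfl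

theorem weakBox_eq (Γ : Set Ag) (P R : Set (State L)) : M.weakBox Γ P R =
    R ∪ (P ∩ ⋂ f ∈ M.F, M.preBox Γ (M.reachBox Γ P (R ∪ (M.weakBox Γ P R ∩ f)))) :=
  (OrderHom.map_gfp _).symm

theorem forceDia_eq (Γ : Set Ag) (P B : Set (State L)) : M.forceDia Γ P B =
    B ∩ (P ∪ ⋃ f ∈ M.F, M.preDia Γ (M.stayDia Γ P (B ∩ (M.forceDia Γ P B ∪ fᶜ)))) :=
  (OrderHom.map_lfp _).symm

theorem compl_weakBox (Γ : Set Ag) (P R : Set (State L)) :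
    (M.weakBox Γ P R)ᶜ = M.forceDia Γ Pᶜ Rᶜ := by
  refine compl_gfp_eq_lfp fun Z => ?_
  change (R ∪ (P ∩ ⋂ f ∈ M.F, M.preBox Γ (M.reachBox Γ P (R ∪ (Z ∩ f)))))ᶜ =
    Rᶜ ∩ (Pᶜ ∪ ⋃ f ∈ M.F, M.preDia Γ (M.stayDia Γ Pᶜ (Rᶜ ∩ (Zᶜ ∪ fᶜ))))
  simp only [Set.compl_union, Set.compl_inter, Set.compl_iInter, compl_preBox, compl_reachBox]

/-- From a state of `weakBox`, each strategy has a compatible finite path in `P` to `R`, or a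
compatible fair path in `P`. -/
theorem exists_of_mem_weakBox (hF : M.F.Nonempty) {Γ : Set Ag} (σ : M.GroupStrategy Γ)
    {P R : Set (State L)} {s : State L} (hs : s ∈ M.weakBox Γ P R) :
    (∃ t ∈ R, ReflTransGen (fun x y => x ∈ P ∧ σ.Succ x y) s t) ∨
      ∃ u, u 0 = s ∧ IsRun σ.Succ u ∧ SeqFair M.F u ∧ ∀ d, u d ∈ P := by
  set r : State L → State L → Prop := fun x y => x ∈ P ∧ σ.Succ x y
  by_cases hR : ∃ t ∈ R, ReflTransGen r s t
  · exact Or.inl hR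
  have key : ∀ x ∈ {x | x ∈ M.weakBox Γ P R ∧ ReflTransGen r s x}, ∀ f ∈ M.F,
      ∃ y ∈ {x | x ∈ M.weakBox Γ P R ∧ ReflTransGen r s x} ∩ f, TransGen r x y := by
    -- As `R` is out of reach from `s`, unfolding the fixed point at `x` always leads back into it
    -- inside `f`. The initial `Pre_[Γ]` step makes the path nonempty even if `x` is already in `f`.
    rintro x ⟨hx, hsx⟩ f hf
    rw [weakBox_eq] at hx
    rcases hx with hx | ⟨hxP, hx⟩
    · exact absurd ⟨x, hx, hsx⟩ hR
    · obtain ⟨z, hz, hxz⟩ := exists_succ_of_mem_preBox σ (Set.mem_iInter₂.mp hx f hf)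
      obtain ⟨y, hy, hzy⟩ := exists_reflTransGen_of_mem_reachBox σ hz
      have hxy : TransGen r x y := TransGen.head' ⟨hxP, hxz⟩ hzy
      have hsy : ReflTransGen r s y := hsx.trans hxy.to_reflTransGen
      rcases hy with hy | ⟨hy, hyf⟩
      · exact absurd ⟨y, hy, hsy⟩ hR
      · exact ⟨y, ⟨⟨hy, hsy⟩, hyf⟩, hxy⟩
  obtain ⟨u, hu0, hu, hfair⟩ := exists_fair_run hF M.finite_F.countable key ⟨hs, .refl⟩
  exact Or.inr ⟨u, hu0, fun d => (hu d).2, hfair, fun d => (hu d).1⟩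

/-- The targets of a memoryless strategy which is winning on `forceDia`: on a run which enters
these targets and never meets `P`, some fairness constraint is finally avoided. -/
theorem exists_target_of_forceDia (hF : M.F.Nonempty) (Γ : Set Ag) (P B : Set (State L)) :
    ∃ Z : State L → Set (State L),
      (∀ s ∈ M.forceDia Γ P B, s ∉ P → s ∈ M.preDia Γ (Z s)) ∧
      (∀ s ∈ M.forceDia Γ P B, s ∉ P → Z s ⊆ M.forceDia Γ P B) ∧
      ∀ u : ℕ → State L, u 0 ∈ M.forceDia Γ P B → (∀ d, u d ∉ P) →
        (∀ d, u (d + 1) ∈ Z (u d)) → ¬ SeqFair M.F u := by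
  obtain ⟨e, he⟩ := M.finite_F.countable.exists_eq_range hF
  let Φ : Set (State L) →o Set (State L) :=
    { toFun := fun Z => B ∩ (P ∪ ⋃ f ∈ M.F, M.preDia Γ (M.stayDia Γ P (B ∩ (Z ∪ fᶜ))))
      monotone' := fun _ _ h => Set.inter_subset_inter_right _ (Set.union_subset_union_right _
        (Set.iUnion₂_mono fun _ _ => (M.preDia Γ).mono (M.stayDia_mono Γ P
          (Set.inter_subset_inter_right _ (Set.union_subset_union_left _ h))))) }
  have hΦ : M.forceDia Γ P B = Φ.lfp := rfl
  let D := OrdinalApprox.lfpApprox Φ ⊥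
  -- For a pair `(b, n)`: the inner set for stage `b` and the `n`-th constraint. The group can keep
  -- the run there until `P`, and such a run avoids that constraint except at states of the earlier
  -- stage `b`.
  let S : Ordinal ×ₗ ℕ → Set (State L) := fun k =>
    M.stayDia Γ P (B ∩ (D (ofLex k).1 ∪ (e (ofLex k).2)ᶜ))
  -- The rank of `s` is the least pair whose set can be forced in one step; `(0, 0)` is a default
  -- value for states without rank.
  have hkey : ∀ s, ∃ k, (∃ k', s ∈ M.preDia Γ (S k')) →
      s ∈ M.preDia Γ (S k) ∧ ∀ k', s ∈ M.preDia Γ (S k') → k ≤ k' := by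
    intro s
    by_cases h : ∃ k', s ∈ M.preDia Γ (S k')
    · refine ⟨wellFounded_lt.min {k | s ∈ M.preDia Γ (S k)} h, fun _ =>
        ⟨wellFounded_lt.min_mem _ h, fun k' hk' => ?_⟩⟩
      exact not_lt.mp (wellFounded_lt.not_lt_min {k | s ∈ M.preDia Γ (S k)} hk')
    · exact ⟨toLex (0, 0), fun h' => absurd h' h⟩
  choose key hkey using hkey
  have hstage : ∀ (a : Ordinal) (s : State L), s ∈ D a → s ∉ P →
      ∃ k, (ofLex k).1 < a ∧ s ∈ M.preDia Γ (S k) := by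
    intro a s hs hP
    obtain ⟨b, hb, -, h | h⟩ := exists_mem_apply_lfpApprox Φ hs
    · exact absurd h hP
    · obtain ⟨f, hf, h⟩ := Set.mem_iUnion₂.mp h
      rw [he] at hf
      obtain ⟨n, rfl⟩ := hf
      exact ⟨toLex (b, n), hb, h⟩
  have hex : ∀ s ∈ M.forceDia Γ P B, s ∉ P → ∃ k, s ∈ M.preDia Γ (S k) := by
    intro s hs hP
    obtain ⟨a, ha⟩ := exists_mem_lfpApprox_of_mem_lfp Φ hs
    obtain ⟨k, -, hk⟩ := hstage a s ha hP
    exact ⟨k, hk⟩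
  have hsub : ∀ k, S k ⊆ M.forceDia Γ P B := by
    intro k s hs
    have hs' : s ∈ M.stayDia Γ P (B ∩ (M.forceDia Γ P B ∪ (e (ofLex k).2)ᶜ)) :=
      M.stayDia_mono Γ P (Set.inter_subset_inter_right _
        (Set.union_subset_union_left _ (lfpApprox_subset_lfp Φ _))) hs
    have hs'' := hs'
    rw [stayDia_eq] at hs''
    rw [forceDia_eq]
    refine ⟨hs''.1.1, hs''.2.imp_right fun h => ?_⟩
    exact Set.mem_iUnion₂.mpr ⟨e (ofLex k).2, by rw [he]; exact ⟨_, rfl⟩, h⟩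
  refine ⟨fun s => S (key s), fun s hs hP => (hkey s (hex s hs hP)).1, fun s _ _ => hsub _, ?_⟩
  intro u h0 hP hu hfair
  have hin : ∀ d, u d ∈ M.forceDia Γ P B := by
    intro d
    cases d with
    | zero => exact h0
    | succ d => exact hsub _ (hu d)
  have hstep : ∀ d, u (d + 1) ∈ M.preDia Γ (S (key (u d))) := by
    intro d
    have h := hu d
    simp only [S] at h
    rw [stayDia_eq] at h
    exact h.2.resolve_left (hP _)
  -- Outside `P`, a state of `S k` can force `S k` again, so its rank is at most `k`.
  have hanti : Antitone fun d => key (u d) := antitone_nat_of_succ_le fun d =>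
    (hkey _ ⟨_, hstep d⟩).2 _ (hstep d)
  obtain ⟨m, hm⟩ : ∃ m, ∀ d, m ≤ d → key (u d) = key (u m) := by
    have hne : (Set.range fun d => key (u d)).Nonempty := ⟨_, 0, rfl⟩
    obtain ⟨m, hm⟩ := wellFounded_lt.min_mem _ hne
    refine ⟨m, fun d hd => le_antisymm (hanti hd) ?_⟩
    have hm' : key (u m) = _ := hm
    rw [hm']
    exact not_lt.mp (wellFounded_lt.not_lt_min (Set.range fun d => key (u d)) ⟨d, rfl⟩)
  -- Otherwise the state lies in the stage named by the constant rank, and would have a rank with a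
  -- strictly smaller ordinal.
  have havoid : ∀ d, m ≤ d → u (d + 1) ∉ e (ofLex (key (u m))).2 := by
    intro d hd
    have h := hu d
    simp only [S, hm d hd] at h
    rw [stayDia_eq] at h
    refine h.1.2.resolve_left fun hD => ?_
    obtain ⟨k, hk, hk'⟩ := hstage _ _ hD (hP _)
    have hle := (hkey _ ⟨_, hk'⟩).2 _ hk'
    rw [hm (d + 1) (by lia)] at hle
    exact absurd hle (not_le.mpr (Prod.Lex.toLex_lt_toLex.mpr (Or.inl hk)))
  have hmem : e (ofLex (key (u m))).2 ∈ M.F := by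
    rw [he]
    exact ⟨_, rfl⟩
  obtain ⟨d, hd, hlt⟩ := (hfair _ hmem).exists_gt m
  have := havoid (d - 1) (by lia)
  rw [show d - 1 + 1 = d by lia] at this
  exact this hd

end Model

end ATLK

namespace ATLK

open Relation

namespace Model

variable {Ag : Type u} {L : Ag → Type v} {Act : Ag → Type w} {AP : Type x}
  {M : Model Ag L Act AP}

/-! ### The operators of `[Γ]` -/

theorem fairBox_eq_weakBox (Γ : Set Ag) : M.fairBox Γ = M.weakBox Γ Set.univ ∅ :=
  boxG_eq_weakBox Γ Set.univ

theorem exists_fair_run_of_mem_fairBox (hF : M.F.Nonempty) {Γ : Set Ag} (σ : M.GroupStrategy Γ)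
    {s : State L} (hs : s ∈ M.fairBox Γ) : ∃ u, u 0 = s ∧ IsRun σ.Succ u ∧ SeqFair M.F u := by
  rw [fairBox_eq_weakBox] at hs
  rcases exists_of_mem_weakBox hF σ hs with ⟨t, ht, -⟩ | ⟨u, h0, hu, hf, -⟩
  · exact absurd ht (Set.notMem_empty t)
  · exact ⟨u, h0, hu, hf⟩

theorem exists_fair_seqUntil_of_reflTransGen (hF : M.F.Nonempty) {Γ : Set Ag}
    (σ : M.GroupStrategy Γ) {P Q : Set (State L)} {s t : State L} (ht : t ∈ Q ∩ M.fairBox Γ)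
    (hst : ReflTransGen (fun x y => x ∈ P ∧ σ.Succ x y) s t) :
    ∃ u, u 0 = s ∧ IsRun σ.Succ u ∧ SeqFair M.F u ∧ SeqUntil u P Q := by
  induction hst using ReflTransGen.head_induction_on with
  | refl =>
    obtain ⟨u, h0, hu, hf⟩ := exists_fair_run_of_mem_fairBox hF σ ht.2
    exact ⟨u, h0, hu, hf, 0, h0 ▸ ht.1, fun e he => absurd he (by lia)⟩
  | head hxy _ ih =>
    obtain ⟨u, h0, hu, hf, hQ⟩ := ih
    exact ⟨_, rfl, hu.cons (h0 ▸ hxy.2), hf.cons _, hQ.cons hxy.1⟩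

/-- There is a strategy with prescribed targets whose compatible fair runs stay in the set of
states from which fairness cannot be prevented. -/
theorem Serial.exists_strategy_fair (h : M.Serial) (hF : M.F.Nonempty) (Γ : Set Ag)
    (Z : State L → Set (State L)) :
    ∃ σ : M.GroupStrategy Γ, ∀ u, IsRun σ.Succ u → SeqFair M.F u → ∀ d, u d ∈ M.fairBox Γ ∧
      (u d ∈ M.preDia Γ (Z (u d)) → u (d + 1) ∈ Z (u d)) := by
  classical
  obtain ⟨Y, hpre, hsub, hwin⟩ := exists_target_of_forceDia hF Γ (∅ : Set (State L)) Set.univ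
  have hN : (M.fairBox Γ)ᶜ = M.forceDia Γ ∅ Set.univ := by
    rw [fairBox_eq_weakBox, compl_weakBox, Set.compl_univ, Set.compl_empty]
  rw [← hN] at hpre hsub hwin
  -- The targets `Y` trap the run outside `fairBox` and make it unfair, so a fair run never gets
  -- there and always meets the targets `Z`.
  obtain ⟨σ, hσ⟩ := h.exists_strategy Γ fun s => if s ∈ M.fairBox Γ then Z s else Y s
  refine ⟨σ, fun u hu hf d => ?_⟩
  have hfair : u d ∈ M.fairBox Γ := by
    by_contra hd
    have hstep : ∀ n, u n ∉ M.fairBox Γ → u (n + 1) ∈ Y (u n) := by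
      intro n hn
      have := hσ (u n)
      simp only [if_neg hn] at this
      exact this (hpre _ hn (Set.notMem_empty _)) _ (hu n)
    have hin : ∀ n, u (d + n) ∉ M.fairBox Γ := by
      intro n
      induction n with
      | zero => exact hd
      | succ n ih => exact hsub _ ih (Set.notMem_empty _) (hstep _ ih)
    exact hwin (fun n => u (d + n)) hd (fun _ => Set.notMem_empty _) (fun n => hstep _ (hin n))
      (hf.shift d)
  refine ⟨hfair, fun hZ => ?_⟩
  have := hσ (u d)
  simp only [if_pos hfair] at this
  exact this hZ _ (hu d)

theorem mem_boxX_iff (h : M.Serial) (hF : M.F.Nonempty) {Γ : Set Ag} {P : Set (State L)}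
    {s : State L} : s ∈ M.boxX Γ P ↔
      ∀ σ : M.GroupStrategy Γ, ∃ u, u 0 = s ∧ IsRun σ.Succ u ∧ SeqFair M.F u ∧ u 1 ∈ P := by
  constructor
  · intro hs σ
    obtain ⟨t, ⟨htP, ht⟩, hst⟩ := exists_succ_of_mem_preBox σ hs
    obtain ⟨u, rfl, hu, hf⟩ := exists_fair_run_of_mem_fairBox hF σ ht
    exact ⟨_, rfl, hu.cons hst, hf.cons _, htP⟩
  · intro hs
    by_contra hn
    obtain ⟨σ, hσ⟩ := h.exists_strategy_fair hF Γ fun _ => (P ∩ M.fairBox Γ)ᶜ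
    obtain ⟨u, rfl, hu, hf, hP⟩ := hs σ
    rw [boxX, ← Set.mem_compl_iff, compl_preBox] at hn
    exact (hσ u hu hf 0).2 hn ⟨hP, (hσ u hu hf 1).1⟩

/-- Conversely, the group aims at the complement of the fixed point. As long as `P` holds, a fair
run stays in that complement, so it cannot be in `Q` then: being fair, it lies in `fairBox`. -/
theorem mem_boxU_iff (h : M.Serial) (hF : M.F.Nonempty) {Γ : Set Ag} {P Q : Set (State L)}
    {s : State L} : s ∈ M.boxU Γ P Q ↔
      ∀ σ : M.GroupStrategy Γ, ∃ u, u 0 = s ∧ IsRun σ.Succ u ∧ SeqFair M.F u ∧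
        SeqUntil u P Q := by
  constructor
  · intro hs σ
    obtain ⟨t, ht, hst⟩ := exists_reflTransGen_of_mem_reachBox σ hs
    exact exists_fair_seqUntil_of_reflTransGen hF σ ht hst
  · intro hs
    by_contra hn
    obtain ⟨σ, hσ⟩ := h.exists_strategy_fair hF Γ fun _ => (M.boxU Γ P Q)ᶜ
    obtain ⟨u, rfl, hu, hf, d, hd, hlt⟩ := hs σ
    have key : ∀ e ≤ d, u e ∉ M.boxU Γ P Q := by
      intro e
      induction e with
      | zero => exact fun _ => hn
      | succ e ih =>
        intro he
        refine (hσ u hu hf e).2 ?_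
        rw [← compl_preBox]
        intro hpre
        refine ih (by lia) ?_
        rw [boxU, reachBox_eq]
        exact Or.inr ⟨hlt e (by lia), hpre⟩
    refine key d le_rfl ?_
    rw [boxU, reachBox_eq]
    exact Or.inl ⟨hd, (hσ u hu hf d).1⟩

/-- Conversely, the rank strategy for the complement keeps the run away from `Q ∩ Fair_[Γ]` while
`P` holds, and makes it unfair if `P` holds forever. -/
theorem mem_boxW_iff (h : M.Serial) (hF : M.F.Nonempty) {Γ : Set Ag} {P Q : Set (State L)}
    {s : State L} : s ∈ M.boxW Γ P Q ↔
      ∀ σ : M.GroupStrategy Γ, ∃ u, u 0 = s ∧ IsRun σ.Succ u ∧ SeqFair M.F u ∧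
        (SeqUntil u P Q ∨ ∀ d, u d ∈ P) := by
  rw [boxW_eq_weakBox]
  constructor
  · intro hs σ
    rcases exists_of_mem_weakBox hF σ hs with ⟨t, ht, hst⟩ | ⟨u, h0, hu, hf, hP⟩
    · obtain ⟨u, h0, hu, hf, hQ⟩ := exists_fair_seqUntil_of_reflTransGen hF σ ht hst
      exact ⟨u, h0, hu, hf, Or.inl hQ⟩
    · exact ⟨u, h0, hu, hf, Or.inr hP⟩
  · intro hs
    by_contra hn
    obtain ⟨Z, hpre, hsub, hwin⟩ := exists_target_of_forceDia hF Γ Pᶜ (Q ∩ M.fairBox Γ)ᶜ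
    have hB : ∀ t ∈ M.forceDia Γ Pᶜ (Q ∩ M.fairBox Γ)ᶜ, t ∉ Q ∩ M.fairBox Γ := by
      intro t ht
      rw [forceDia_eq] at ht
      exact ht.1
    rw [← Set.mem_compl_iff, compl_weakBox] at hn
    obtain ⟨σ, hσ⟩ := h.exists_strategy_fair hF Γ Z
    obtain ⟨u, rfl, hu, hf, hψ⟩ := hs σ
    have hstep : ∀ e, u e ∈ M.forceDia Γ Pᶜ (Q ∩ M.fairBox Γ)ᶜ → u e ∈ P →
        u (e + 1) ∈ Z (u e) := fun e he heP =>
      (hσ u hu hf e).2 (hpre _ he fun hc => hc heP)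
    have key : ∀ d, (∀ e < d, u e ∈ P) → u d ∈ M.forceDia Γ Pᶜ (Q ∩ M.fairBox Γ)ᶜ := by
      intro d
      induction d with
      | zero => exact fun _ => hn
      | succ d ih =>
        intro hlt
        have hd := ih fun e he => hlt e (by lia)
        have hP := hlt d (by lia)
        exact hsub _ hd (fun hc => hc hP) (hstep d hd hP)
    rcases hψ with ⟨d, hd, hlt⟩ | hP
    · exact hB _ (key d hlt) ⟨hd, (hσ u hu hf d).1⟩
    · exact hwin u hn (fun d hc => hc (hP d))
        (fun d => hstep d (key d fun e _ => hP e) (hP d)) hf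

theorem mem_boxG_iff (h : M.Serial) (hF : M.F.Nonempty) {Γ : Set Ag} {P : Set (State L)}
    {s : State L} : s ∈ M.boxG Γ P ↔
      ∀ σ : M.GroupStrategy Γ, ∃ u, u 0 = s ∧ IsRun σ.Succ u ∧ SeqFair M.F u ∧
        ∀ d, u d ∈ P := by
  have : M.boxG Γ P = M.boxW Γ P ∅ := by
    rw [boxW_eq_weakBox, boxG_eq_weakBox, Set.empty_inter]
  rw [this, mem_boxW_iff h hF]
  simp [SeqUntil]

/-! ### The direct computation of `⟨Γ⟩` -/

theorem diaX_eq (Γ : Set Ag) (P : Set (State L)) : M.diaX Γ P = (M.boxX Γ Pᶜ)ᶜ := by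
  rw [diaX, boxX, compl_preBox, Set.compl_inter, compl_compl]

theorem diaG_eq (Γ : Set Ag) (P : Set (State L)) :
    M.diaG Γ P = (M.boxU Γ Set.univ Pᶜ)ᶜ := by
  refine (compl_lfp_eq_gfp fun Z => ?_).symm
  change ((Pᶜ ∩ M.fairBox Γ) ∪ (Set.univ ∩ M.preBox Γ Z))ᶜ =
    (P ∪ (M.fairBox Γ)ᶜ) ∩ M.preDia Γ Zᶜ
  rw [Set.compl_union, Set.univ_inter, Set.compl_inter, compl_compl, compl_preBox]

theorem compl_inter_compl_inter_fairBox (Γ : Set Ag) (P Q : Set (State L)) :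
    (Pᶜ ∩ Qᶜ ∩ M.fairBox Γ)ᶜ = P ∪ Q ∪ (M.fairBox Γ)ᶜ := by
  rw [Set.compl_inter, Set.compl_inter, compl_compl, compl_compl]

theorem diaU_eq (Γ : Set Ag) (P Q : Set (State L)) :
    M.diaU Γ P Q = (M.boxW Γ Qᶜ (Pᶜ ∩ Qᶜ))ᶜ := by
  rw [boxW_eq_weakBox, compl_weakBox, compl_inter_compl_inter_fairBox, compl_compl,
    diaU_eq_forceDia]

theorem diaW_eq (Γ : Set Ag) (P Q : Set (State L)) :
    M.diaW Γ P Q = (M.boxU Γ Qᶜ (Pᶜ ∩ Qᶜ))ᶜ := by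
  rw [boxU, compl_reachBox, compl_inter_compl_inter_fairBox, compl_compl, diaW]

/-! ### The operators of `E` and `A` -/

theorem mem_ctlU_iff (h : M.Serial) {P Q : Set (State L)} {s : State L} :
    s ∈ ctlU M.preE P Q ↔ ∃ u, u 0 = s ∧ IsRun M.Succ u ∧ SeqUntil u P Q := by
  have heq : ctlU M.preE P Q = Q ∪ (P ∩ M.preE (ctlU M.preE P Q)) := (OrderHom.map_lfp _).symm
  constructor
  · intro hs
    refine OrderHom.lfp_le _ (a := {s | ∃ u, u 0 = s ∧ IsRun M.Succ u ∧ SeqUntil u P Q}) ?_ hs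
    rintro s (hs | ⟨hP, hs⟩)
    · obtain ⟨u, rfl, hu, -⟩ := exists_run_of_total h.succ (fun _ => ∅) s
      exact ⟨u, rfl, hu, 0, hs, fun e he => absurd he (by lia)⟩
    · obtain ⟨t, ⟨u, rfl, hu, hQ⟩, hst⟩ := mem_preE_iff.mp hs
      exact ⟨_, rfl, hu.cons hst, hQ.cons hP⟩
  · rintro ⟨u, rfl, hu, hQ⟩
    refine hQ.mem_of_closed (S := ctlU M.preE P Q) (fun x hx => ?_)
      (fun x hx y hy hxy => ?_) hu
    · rw [heq]
      exact Or.inl hx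
    · rw [heq]
      exact Or.inr ⟨hx, mem_preE_iff.mpr ⟨y, hy, hxy⟩⟩

theorem mem_ctlW_iff (h : M.Serial) {P Q : Set (State L)} {s : State L} :
    s ∈ ctlW M.preE P Q ↔
      ∃ u, u 0 = s ∧ IsRun M.Succ u ∧ (SeqUntil u P Q ∨ ∀ d, u d ∈ P) := by
  have heq : ctlW M.preE P Q = Q ∪ (P ∩ M.preE (ctlW M.preE P Q)) := (OrderHom.map_gfp _).symm
  constructor
  · intro hs
    -- This run stays in the fixed point until `Q` is met; afterwards it may continue arbitrarily.
    obtain ⟨u, rfl, hu, hZ⟩ := exists_run_of_total h.succ (fun _ => ctlW M.preE P Q) s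
    refine ⟨u, rfl, hu, ?_⟩
    by_cases hQ : ∃ d, u d ∈ Q ∧ ∀ e < d, u e ∈ P
    · exact Or.inl hQ
    · right
      have key : ∀ d, u d ∈ ctlW M.preE P Q ∧ ∀ e < d, u e ∈ P := by
        intro d
        induction d with
        | zero => exact ⟨hs, fun e he => absurd he (by lia)⟩
        | succ d ih =>
          obtain ⟨hd, hlt⟩ := ih
          rw [heq] at hd
          rcases hd with hd | ⟨hd, hpre⟩
          · exact absurd ⟨d, hd, hlt⟩ hQ
          · refine ⟨hZ d (mem_preE_iff.mp hpre), fun e he => ?_⟩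
            rcases Nat.lt_succ_iff_lt_or_eq.mp he with he | rfl
            · exact hlt e he
            · exact hd
      exact fun d => (key (d + 1)).2 d (by lia)
  · intro hs
    refine OrderHom.le_gfp _
      (a := {s | ∃ u, u 0 = s ∧ IsRun M.Succ u ∧ (SeqUntil u P Q ∨ ∀ d, u d ∈ P)}) ?_ hs
    rintro _ ⟨u, rfl, hu, hψ⟩
    have hpre : ∀ (h' : SeqUntil (fun d => u (1 + d)) P Q ∨ ∀ d, u (1 + d) ∈ P), u 0 ∈ M.preE
        {s | ∃ u, u 0 = s ∧ IsRun M.Succ u ∧ (SeqUntil u P Q ∨ ∀ d, u d ∈ P)} := fun h' =>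
      mem_preE_iff.mpr ⟨u 1, ⟨_, rfl, hu.shift 1, h'⟩, hu 0⟩
    rcases hψ with ⟨d, hd, hlt⟩ | hP
    · cases d with
      | zero => exact Or.inl hd
      | succ d =>
        refine Or.inr ⟨hlt 0 (by lia), hpre (Or.inl ⟨d, ?_, fun e he => hlt _ (by lia)⟩)⟩
        rwa [add_comm d 1] at hd
    · exact Or.inr ⟨hP 0, hpre (Or.inr fun d => hP _)⟩

theorem mem_ctlG_iff (h : M.Serial) {P : Set (State L)} {s : State L} :
    s ∈ ctlG M.preE P ↔ ∃ u, u 0 = s ∧ IsRun M.Succ u ∧ ∀ d, u d ∈ P := by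
  have : ctlG M.preE P = ctlW M.preE P ∅ := by
    unfold ctlG ctlW
    simp only [Set.empty_union]
  rw [this, mem_ctlW_iff h]
  simp [SeqUntil]

theorem preA_eq (P : Set (State L)) : M.preA P = (M.preE Pᶜ)ᶜ := by
  rw [compl_preE, compl_compl]

theorem ctlG_preA_eq (P : Set (State L)) :
    ctlG M.preA P = (ctlU M.preE Set.univ Pᶜ)ᶜ := by
  refine (compl_lfp_eq_gfp fun Z => ?_).symm
  change (Pᶜ ∪ (Set.univ ∩ M.preE Z))ᶜ = P ∩ M.preA Zᶜ
  rw [Set.compl_union, Set.univ_inter, compl_compl, compl_preE]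

theorem compl_union_inter_eq (P Q A : Set (State L)) :
    ((Pᶜ ∩ Qᶜ) ∪ (Qᶜ ∩ A))ᶜ = Q ∪ (P ∩ Aᶜ) := by
  ext s
  simp only [Set.mem_compl_iff, Set.mem_union, Set.mem_inter_iff]
  tauto

theorem ctlU_preA_eq (P Q : Set (State L)) :
    ctlU M.preA P Q = (ctlW M.preE Qᶜ (Pᶜ ∩ Qᶜ))ᶜ := by
  refine (compl_gfp_eq_lfp fun Z => ?_).symm
  change ((Pᶜ ∩ Qᶜ) ∪ (Qᶜ ∩ M.preE Z))ᶜ = Q ∪ (P ∩ M.preA Zᶜ)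
  rw [compl_union_inter_eq, compl_preE]

theorem ctlW_preA_eq (P Q : Set (State L)) :
    ctlW M.preA P Q = (ctlU M.preE Qᶜ (Pᶜ ∩ Qᶜ))ᶜ := by
  refine (compl_lfp_eq_gfp fun Z => ?_).symm
  change ((Pᶜ ∩ Qᶜ) ∪ (Qᶜ ∩ M.preE Z))ᶜ = Q ∪ (P ∩ M.preA Zᶜ)
  rw [compl_union_inter_eq, compl_preE]

/-! ### Correctness of the temporal operators -/

theorem quantHolds_next_iff (h : M.Serial) (hF : M.F.Nonempty) (P : Set (State L))
    (m : DiaMode) (Q : Quant Ag) (s : State L) :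
    M.quantHolds s (fun π => π.st 1 ∈ P) Q ↔ s ∈ M.evalX P m Q := by
  have hE : ∀ P : Set (State L), M.quantHolds s (fun π => π.st 1 ∈ P) .E ↔ s ∈ M.preE P := by
    intro P
    rw [M.quantHolds_E (fun u => u 1 ∈ P) fun _ => Iff.rfl, mem_preE_iff]
    constructor
    · rintro ⟨u, rfl, hu, hP⟩
      exact ⟨_, hP, hu 0⟩
    · rintro ⟨t, ht, hst⟩
      obtain ⟨u, rfl, hu, -⟩ := exists_run_of_total h.succ (fun _ => ∅) t
      exact ⟨_, rfl, hu.cons hst, ht⟩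
  have hbox : ∀ (Γ : Set Ag) (P : Set (State L)),
      M.quantHolds s (fun π => π.st 1 ∈ P) (.box Γ) ↔ s ∈ M.boxX Γ P := fun Γ P => by
    rw [mem_boxX_iff h hF, M.quantHolds_box (fun u => u 1 ∈ P) fun _ => Iff.rfl]
  have hdia : ∀ Γ : Set Ag,
      M.quantHolds s (fun π => π.st 1 ∈ P) (.dia Γ) ↔ s ∈ (M.boxX Γ Pᶜ)ᶜ := fun Γ => by
    rw [quantHolds_dia, Set.mem_compl_iff, ← hbox]
    rfl
  cases Q with
  | E => exact hE P
  | A =>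
    change _ ↔ s ∈ M.preA P
    rw [quantHolds_A, preA_eq, Set.mem_compl_iff, ← hE]
    rfl
  | box Γ => exact hbox Γ P
  | dia Γ =>
    cases m with
    | viaBox => exact hdia Γ
    | direct => exact (hdia Γ).trans (by rw [← diaX_eq]; rfl)

theorem quantHolds_box_until_iff (h : M.Serial) (hF : M.F.Nonempty) (Γ : Set Ag)
    {P Q : Set (State L)} {s : State L} {ψ : M.Path → Prop}
    (hψ : ∀ π, ψ π ↔ SeqUntil π.st P Q) :
    M.quantHolds s ψ (.box Γ) ↔ s ∈ M.boxU Γ P Q := by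
  rw [mem_boxU_iff h hF, M.quantHolds_box (fun u => SeqUntil u P Q) hψ]

theorem quantHolds_box_weak_iff (h : M.Serial) (hF : M.F.Nonempty) (Γ : Set Ag)
    {P Q : Set (State L)} {s : State L} {ψ : M.Path → Prop}
    (hψ : ∀ π, ψ π ↔ SeqUntil π.st P Q ∨ ∀ d, π.st d ∈ P) :
    M.quantHolds s ψ (.box Γ) ↔ s ∈ M.boxW Γ P Q := by
  rw [mem_boxW_iff h hF, M.quantHolds_box (fun u => SeqUntil u P Q ∨ ∀ d, u d ∈ P) hψ]

theorem quantHolds_E_until_iff (h : M.Serial)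
    {P Q : Set (State L)} {s : State L} {ψ : M.Path → Prop}
    (hψ : ∀ π, ψ π ↔ SeqUntil π.st P Q) :
    M.quantHolds s ψ .E ↔ s ∈ ctlU M.preE P Q := by
  rw [mem_ctlU_iff h, M.quantHolds_E (fun u => SeqUntil u P Q) hψ]

theorem quantHolds_E_weak_iff (h : M.Serial)
    {P Q : Set (State L)} {s : State L} {ψ : M.Path → Prop}
    (hψ : ∀ π, ψ π ↔ SeqUntil π.st P Q ∨ ∀ d, π.st d ∈ P) :
    M.quantHolds s ψ .E ↔ s ∈ ctlW M.preE P Q := by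
  rw [mem_ctlW_iff h, M.quantHolds_E (fun u => SeqUntil u P Q ∨ ∀ d, u d ∈ P) hψ]

theorem quantHolds_glob_iff (h : M.Serial) (hF : M.F.Nonempty) (P : Set (State L))
    (m : DiaMode) (Q : Quant Ag) (s : State L) :
    M.quantHolds s (fun π => π.Globally P) Q ↔ s ∈ M.evalG P m Q := by
  have hdia : ∀ Γ : Set Ag,
      M.quantHolds s (fun π => π.Globally P) (.dia Γ) ↔ s ∈ (M.boxU Γ Set.univ Pᶜ)ᶜ := by
    intro Γ
    exact quantHolds_dia.trans
      (not_congr (quantHolds_box_until_iff h hF Γ fun _ => not_forall_mem_iff_seqUntil))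
  cases Q with
  | E =>
    change _ ↔ s ∈ ctlG M.preE P
    exact (M.quantHolds_E (fun u => ∀ d, u d ∈ P) fun _ => Iff.rfl).trans (mem_ctlG_iff h).symm
  | A =>
    change _ ↔ s ∈ ctlG M.preA P
    rw [ctlG_preA_eq]
    exact quantHolds_A.trans
      (not_congr (quantHolds_E_until_iff h fun _ => not_forall_mem_iff_seqUntil))
  | box Γ =>
    change _ ↔ s ∈ M.boxG Γ P
    exact (M.quantHolds_box (fun u => ∀ d, u d ∈ P) fun _ => Iff.rfl).trans
      (mem_boxG_iff h hF).symm
  | dia Γ =>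
    cases m with
    | viaBox => exact hdia Γ
    | direct => exact (hdia Γ).trans (by rw [← diaG_eq]; rfl)

theorem quantHolds_until_iff (h : M.Serial) (hF : M.F.Nonempty) (P R : Set (State L))
    (m : DiaMode) (Q : Quant Ag) (s : State L) :
    M.quantHolds s (fun π => π.Until P R) Q ↔ s ∈ M.evalU P R m Q := by
  have hdia : ∀ Γ : Set Ag,
      M.quantHolds s (fun π => π.Until P R) (.dia Γ) ↔ s ∈ (M.boxW Γ Rᶜ (Pᶜ ∩ Rᶜ))ᶜ := by
    intro Γ
    exact quantHolds_dia.trans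
      (not_congr (quantHolds_box_weak_iff h hF Γ fun _ => not_seqUntil_iff))
  cases Q with
  | E => exact quantHolds_E_until_iff h fun _ => Iff.rfl
  | A =>
    change _ ↔ s ∈ ctlU M.preA P R
    rw [ctlU_preA_eq]
    exact quantHolds_A.trans
      (not_congr (quantHolds_E_weak_iff h fun _ => not_seqUntil_iff))
  | box Γ => exact quantHolds_box_until_iff h hF Γ fun _ => Iff.rfl
  | dia Γ =>
    cases m with
    | viaBox => exact hdia Γ
    | direct => exact (hdia Γ).trans (by rw [← diaU_eq]; rfl)

theorem quantHolds_weak_iff (h : M.Serial) (hF : M.F.Nonempty) (P R : Set (State L))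
    (m : DiaMode) (Q : Quant Ag) (s : State L) :
    M.quantHolds s (fun π => π.Until P R ∨ π.Globally P) Q ↔ s ∈ M.evalW P R m Q := by
  have hdia : ∀ Γ : Set Ag, M.quantHolds s (fun π => π.Until P R ∨ π.Globally P) (.dia Γ) ↔
      s ∈ (M.boxU Γ Rᶜ (Pᶜ ∩ Rᶜ))ᶜ := by
    intro Γ
    exact quantHolds_dia.trans
      (not_congr (quantHolds_box_until_iff h hF Γ fun _ => not_seqUntil_or_forall_iff))
  cases Q with
  | E => exact quantHolds_E_weak_iff h fun _ => Iff.rfl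
  | A =>
    change _ ↔ s ∈ ctlW M.preA P R
    rw [ctlW_preA_eq]
    exact quantHolds_A.trans
      (not_congr (quantHolds_E_until_iff h fun _ => not_seqUntil_or_forall_iff))
  | box Γ => exact quantHolds_box_weak_iff h hF Γ fun _ => Iff.rfl
  | dia Γ =>
    cases m with
    | viaBox => exact hdia Γ
    | direct => exact (hdia Γ).trans (by rw [← diaW_eq]; rfl)

/-! ### Correctness of the epistemic operators -/

theorem mem_reachSet_iff (h : M.Serial) {s : State L} : s ∈ M.reachSet ↔ M.Reachable s := by
  have heq : M.reachSet = M.I ∪ {t | ∃ s ∈ M.reachSet, ∃ a, M.T s a t} :=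
    (OrderHom.map_lfp _).symm
  constructor
  · intro hs
    have hsub : M.reachSet ⊆ {s | ∃ t ∈ M.I, ReflTransGen M.Succ t s} := by
      refine OrderHom.lfp_le _ ?_
      rintro t (ht | ⟨s, ⟨r, hr, hrs⟩, hst⟩)
      · exact ⟨t, ht, .refl⟩
      · exact ⟨r, hr, hrs.tail hst⟩
    obtain ⟨t, ht, hts⟩ := hsub hs
    have : ∃ u, u 0 = t ∧ IsRun M.Succ u ∧ ∃ d, u d = s := by
      clear ht
      induction hts using ReflTransGen.head_induction_on with
      | refl =>
        -- Reachability refers to infinite paths; seriality extends the finite one beyond `s`.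
        obtain ⟨u, h0, hu, -⟩ := exists_run_of_total h.succ (fun _ => ∅) s
        exact ⟨u, h0, hu, 0, h0⟩
      | head hxy _ ih =>
        obtain ⟨u, rfl, hu, d, hd⟩ := ih
        exact ⟨_, rfl, hu.cons hxy, d + 1, hd⟩
    obtain ⟨u, rfl, hu, hd⟩ := this
    obtain ⟨π, rfl⟩ := M.exists_path_of_isRun hu
    exact ⟨π, ht, hd⟩
  · rintro ⟨π, h0, d, rfl⟩
    induction d with
    | zero =>
      rw [heq]
      exact Or.inl h0
    | succ d ih =>
      rw [heq]
      exact Or.inr ⟨_, ih, _, π.step d⟩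

/-- The empty group restricts no action, so every path is compatible with its only strategy. -/
theorem mem_fairBox_empty_iff (h : M.Serial) (hF : M.F.Nonempty) {s : State L} :
    s ∈ M.fairBox ∅ ↔ M.FairState s := by
  rw [fairBox, mem_boxG_iff h hF]
  constructor
  · intro hs
    obtain ⟨u, rfl, hu, hf, -⟩ := hs fun i => i.2.elim
    obtain ⟨π, hπ, rfl⟩ := exists_mem_out_of_isRun hu
    exact ⟨π, rfl, hf⟩
  · rintro ⟨π, rfl, hf⟩ σ
    exact ⟨π.st, rfl, fun d => ⟨_, fun i => i.2.elim, π.step d⟩, hf, fun _ => trivial⟩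

theorem mem_fairReach_iff (h : M.Serial) (hF : M.F.Nonempty) {s : State L} :
    s ∈ M.fairReach ↔ M.Reachable s ∧ M.FairState s :=
  and_congr (mem_reachSet_iff h) (mem_fairBox_empty_iff h hF)

theorem knowsSet_eq_evalK (h : M.Serial) (hF : M.F.Nonempty) (i : Ag) (P : Set (State L)) :
    M.knowsSet i P = M.evalK i P := by
  ext s
  change (∀ t, t i = s i → M.Reachable t → M.FairState t → t ∈ P) ↔
    ¬ ∃ t, (t ∈ M.fairReach ∧ t ∉ P) ∧ t i = s i
  simp only [mem_fairReach_iff h hF, not_exists]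
  exact forall_congr' fun t => by tauto

theorem mem_evalD_iff (h : M.Serial) (hF : M.F.Nonempty) {Γ : Set Ag} {P : Set (State L)}
    {s : State L} : s ∈ M.evalD Γ P ↔
      ∀ t, (∀ i ∈ Γ, t i = s i) → M.Reachable t → M.FairState t → t ∈ P := by
  change (¬ ∃ t, (t ∈ M.fairReach ∧ t ∉ P) ∧ ∀ i ∈ Γ, t i = s i) ↔ _
  simp only [mem_fairReach_iff h hF, not_exists]
  exact forall_congr' fun t => by tauto

theorem everyoneSet_eq_evalE (h : M.Serial) (hF : M.F.Nonempty) (Γ : Set Ag)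
    (P : Set (State L)) : M.everyoneSet Γ P = M.evalE Γ P := by
  ext s
  simp only [evalE, Set.mem_iInter₂, ← knowsSet_eq_evalK h hF]
  rfl

theorem everyoneSet_iInter {ι : Sort*} (Γ : Set Ag) (P : ι → Set (State L)) :
    M.everyoneSet Γ (⋂ k, P k) = ⋂ k, M.everyoneSet Γ (P k) := by
  ext s
  simp only [everyoneSet, knowsSet, Set.mem_iInter, Set.mem_ofPred_eq]
  exact ⟨fun h k i hi t h1 h2 h3 => h i hi t h1 h2 h3 k,
    fun h i hi t h1 h2 h3 k => h k i hi t h1 h2 h3⟩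

theorem everyoneSet_mono (Γ : Set Ag) : Monotone (M.everyoneSet Γ) :=
  fun _ _ hPQ _ h i hi t h1 h2 h3 => hPQ (h i hi t h1 h2 h3)

/-- Because `E_Γ` commutes with intersections, the greatest fixed point is already the intersection
of the finite iterates; no transfinite stages are needed. -/
theorem mem_evalC_iff (h : M.Serial) (hF : M.F.Nonempty) {Γ : Set Ag} {P : Set (State L)}
    {s : State L} : s ∈ M.evalC Γ P ↔ ∀ k : ℕ, 1 ≤ k → s ∈ (M.everyoneSet Γ)^[k] P := by
  have heq : M.evalC Γ P = M.everyoneSet Γ (P ∩ M.evalC Γ P) := by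
    rw [everyoneSet_eq_evalE h hF]
    exact (OrderHom.map_gfp _).symm
  constructor
  · intro hs k hk
    obtain ⟨k, rfl⟩ := Nat.exists_eq_add_of_le' hk
    suffices hsub : M.evalC Γ P ⊆ (M.everyoneSet Γ)^[k + 1] P from hsub hs
    clear hk
    induction k with
    | zero =>
      rw [heq]
      exact everyoneSet_mono Γ Set.inter_subset_left
    | succ k ih =>
      rw [heq, Function.iterate_succ_apply']
      exact everyoneSet_mono Γ (Set.inter_subset_right.trans ih)
  · intro hs
    refine OrderHom.le_gfp _ (a := ⋂ k : ℕ, (M.everyoneSet Γ)^[k + 1] P) ?_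
      (Set.mem_iInter.mpr fun k => hs _ (by lia))
    change _ ⊆ M.evalE Γ (P ∩ ⋂ k : ℕ, (M.everyoneSet Γ)^[k + 1] P)
    -- `P` is the iterate of index `0`; applying `E_Γ` to the whole intersection then shifts the
    -- index back to `k + 1`.
    have : P ∩ ⋂ k : ℕ, (M.everyoneSet Γ)^[k + 1] P = ⋂ k : ℕ, (M.everyoneSet Γ)^[k] P := by
      ext t
      simp only [Set.mem_inter_iff, Set.mem_iInter]
      refine ⟨fun ht k => ?_, fun ht => ⟨ht 0, fun k => ht (k + 1)⟩⟩
      cases k with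
      | zero => exact ht.1
      | succ k => exact ht.2 k
    rw [this, ← everyoneSet_eq_evalE h hF, everyoneSet_iInter]
    simp only [Function.iterate_succ_apply']
    exact subset_rfl

/-- The algorithm computes the set of the states which satisfy the formula. -/
theorem setOf_sat_eq_eval (h : M.Serial) (hF : M.F.Nonempty) (m : DiaMode)
    (φ : Formula Ag AP) : {s | M.Sat φ s} = M.eval m φ := by
  induction φ with
  | top => ext s; exact ⟨fun _ => trivial, fun _ => trivial⟩
  | atom p => rfl
  | neg φ ih => rw [eval, ← ih]; rfl
  | conj φ ψ ih₁ ih₂ => rw [eval, ← ih₁, ← ih₂]; rfl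
  | disj φ ψ ih₁ ih₂ => rw [eval, ← ih₁, ← ih₂]; rfl
  | knows i φ ih => rw [eval, ← ih, ← knowsSet_eq_evalK h hF]; rfl
  | everyone Γ φ ih => rw [eval, ← ih, ← everyoneSet_eq_evalE h hF]; rfl
  | distributed Γ φ ih =>
    rw [eval, ← ih]
    ext s
    exact (mem_evalD_iff h hF).symm
  | common Γ φ ih =>
    rw [eval, ← ih]
    ext s
    exact (mem_evalC_iff h hF).symm
  | next Q φ ih =>
    rw [eval, ← ih]
    ext s
    exact quantHolds_next_iff h hF _ m Q s
  | glob Q φ ih =>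
    rw [eval, ← ih]
    ext s
    exact quantHolds_glob_iff h hF _ m Q s
  | untl Q φ ψ ih₁ ih₂ =>
    rw [eval, ← ih₁, ← ih₂]
    ext s
    exact quantHolds_until_iff h hF _ _ m Q s
  | weak Q φ ψ ih₁ ih₂ =>
    rw [eval, ← ih₁, ← ih₂]
    ext s
    exact quantHolds_weak_iff h hF _ _ m Q s

end Model

end ATLK

theorem theorem1 {Ag : Type*} [Finite Ag] {L : Ag → Type*} {Act : Ag → Type*} {AP : Type*}
    (M : ATLK.Model Ag L Act AP) (hserial : M.Serial) (hF : M.F.Nonempty)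
    (m : ATLK.Model.DiaMode) (φ : ATLK.Formula Ag AP) (s : ATLK.State L) :
    M.Sat φ s ↔ s ∈ M.eval m φ := by
  rw [← ATLK.Model.setOf_sat_eq_eval hserial hF m φ]
  rfl
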